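/- Let $W(\cdot)$ be a path-continuous, intrinsically stationary Gaussian random field on $\mathbb{R}^d$ with mean $0$, variance function $\sigma^2(t)=\operatorname{Var}(W(t))$ and variogram $\gamma(h)=\tfrac12\mathbb{E}(W(h)-W(0))^2$, and assume $$\lim_{|t|\to\infty}\Big(W(t)-\frac{\sigma^2(t)}2\Big)=-\infty\quad\text{almost surely.}$$ Let $W_i^{(j)}$, $i\in\mathbb{N}$, $j\in\mathbb{Z}^d$, be independent path-continuous copies of $W$, and let $$T_i^{(j)}:=\inf\Big(\operatorname*{argsup}_{t\in\mathbb{R}^d}\Big(W_i^{(j)}(t)-\frac{\sigma^2(t)}2\Big)\Big)$$ (coordinatewise infimum of the set of maximisers). Let $m\in\mathbb{N}=\{1,2,\dots\}$ and $p\in(0,\infty)^d$, and let $\Pi^{(j)}=\sum_{i\in\mathbb{N}}\delta_{X_i^{(j)}}$, $j\in\mathbb{Z}^d$, be independent Poisson point processes on $\mathbb{R}$ with intensity $m^{-d}e^{-x}\,dx$, whose points $(X_i^{(j)})_{i,j}$ are independent of the family $(W_i^{(j)})_{i,j}$. Put $$Z_3(t):=\max_{j\in\mathbb{Z}^d}\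 \max_{\substack{i\in\mathbb{N}\\ T_i^{(j)}\in(-\frac{mp}2,\frac{mp}2]}}\Big(X_i^{(j)}+W_i^{(j)}(t-p\cdot j)-\frac{\sigma^2(t-p\cdot j)}2\Big),\qquad t\in\mathbb{R}^d,$$ where $p\cdot j=(p_1j_1,\dots,p_dj_d)$ and $(-\frac{mp}2,\frac{mp}2]=\prod_{k=1}^d(-\frac{mp_k}2,\frac{mp_k}2]$. Then, for every $t$, the maximum defining $Z_3(t)$ almost surely exists, and $Z_3$ is a Brown–Resnick process for the variogram $\gamma$; that is, $Z_3$ has the same law (as a random field on $\mathbb{R}^d$) as every Brown–Resnick process $Z$ for $\gamma$. Here a Brown–Resnick process for $\gamma$ is a field $Z(t)=\max_{i\in\mathbb{N}}\big(X_i+\widetilde W_i(t)-\tfrac12\operatorname{Var}\widetilde W_1(t)\big)$, where the $\widetilde W_i$ are i.i.d. path-continuous, intrinsically stationary, centred Gaussian random fields with variogram $\gamma$, and $\sum_i\delta_{X_i}$ is a Poisson point process on $\mathbb{R}$ with intensity $e^{-x}\,dx$ whose points are independent of $(\widetilde W_i)_i$. -/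

import Mathlib

open MeasureTheory ProbabilityTheory Filter Topology

noncomputable section

/-! ### Random fields on `ℝ^d` -/

section Fields

variable {Ω : Type*} [MeasurableSpace Ω] {d : ℕ}

/-- A random field with finite second moments is weakly stationary if `E Y(t)` and
`Cov(Y(x + t), Y(t))` do not depend on `t`. -/
structure IsWeaklyStationary (Y : (Fin d → ℝ) → Ω → ℝ) (P : Measure Ω) : Prop where
  memLp : ∀ t, MemLp (Y t) 2 P
  mean : ∀ s t, ∫ ω, Y s ω ∂P = ∫ ω, Y t ω ∂P
  cov : ∀ x s t, covariance (Y (x + s)) (Y s) P = covariance (Y (x + t)) (Y t) P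

/-- A random field is intrinsically stationary if all its increment fields
`x ↦ W(x + h) - W(x)` are weakly stationary. -/
def IsIntrinsicallyStationary (W : (Fin d → ℝ) → Ω → ℝ) (P : Measure Ω) : Prop :=
  ∀ h : Fin d → ℝ, IsWeaklyStationary (fun x ω => W (x + h) ω - W x ω) P

/-- The (semi-)variogram `γ(h) = E (W(h) - W(0))² / 2`. -/
def variogram (W : (Fin d → ℝ) → Ω → ℝ) (P : Measure Ω) (h : Fin d → ℝ) : ℝ :=
  (1 / 2) * ∫ ω, (W h ω - W 0 ω) ^ 2 ∂P

/-- A path-continuous, intrinsically stationary, centred Gaussian random field on `ℝ^d`. -/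
structure IsIntrinsicGaussianField (W : (Fin d → ℝ) → Ω → ℝ) (P : Measure Ω) : Prop where
  measurable : ∀ t, Measurable (W t)
  continuous : ∀ ω, Continuous fun t => W t ω
  gaussian : IsGaussianProcess W P
  mean_zero : ∀ t, ∫ ω, W t ω ∂P = 0
  intrinsic : IsIntrinsicallyStationary W P

/-- The path-continuous fields `V i`, `i ∈ ι`, are independent copies of the field `W`
(laws of fields are laws on `ℝ^d → ℝ` with the product `σ`-algebra). -/
structure AreIndepCopies {ι Ω₀ : Type*} [MeasurableSpace Ω₀]
    (V : ι → (Fin d → ℝ) → Ω → ℝ) (P : Measure Ω)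
    (W : (Fin d → ℝ) → Ω₀ → ℝ) (P₀ : Measure Ω₀) : Prop where
  measurable : ∀ i t, Measurable (V i t)
  continuous : ∀ i ω, Continuous fun t => V i t ω
  identDistrib : ∀ i, IdentDistrib (fun ω t => V i t ω) (fun ω t => W t ω) P P₀
  indep : iIndepFun (fun i ω t => V i t ω) P

end Fields

/-! ### Poisson point processes -/

section Poisson

variable {Ω S : Type*} [MeasurableSpace Ω] [MeasurableSpace S]

/-- The Poisson distribution with parameter `r ∈ [0, ∞]`, as a law on `[0, ∞]`; for `r = ∞` it is
the point mass at `∞`. -/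
def extPoisson (r : ENNReal) : Measure ENNReal :=
  if r = ⊤ then Measure.dirac ⊤ else (poissonMeasure r.toNNReal).map (fun n : ℕ => (n : ENNReal))

/-- The random counting measure `∑ i, δ_{X i}`. -/
def pointMeasure (X : ℕ → Ω → S) (ω : Ω) : Measure S :=
  Measure.sum fun i => Measure.dirac (X i ω)

/-- The random counting measure `N` is a Poisson point process with intensity measure `μ`. -/
structure IsPoissonPointProcess (N : Ω → Measure S) (μ : Measure S) (P : Measure Ω) : Prop where
  measurable : Measurable N
  counting : ∀ ω A, MeasurableSet A → ∃ n : ℕ∞, N ω A = (n : ENNReal)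
  indep : ∀ (n : ℕ) (A : Fin n → Set S), (∀ k, MeasurableSet (A k)) →
    Pairwise (Function.onFun Disjoint A) → iIndepFun (fun k ω => N ω (A k)) P
  hasLaw : ∀ A, MeasurableSet A → HasLaw (fun ω => N ω A) (extPoisson (μ A)) P

/-- The measure `e^{-x} dx` on `ℝ`. -/
def expIntensity : Measure ℝ :=
  (volume : Measure ℝ).withDensity fun x => ENNReal.ofReal (Real.exp (-x))

end Poisson

/-! ### Brown–Resnick processes -/

section BrownResnick

variable {Ω : Type*} [MeasurableSpace Ω] {d : ℕ}

/-- `Z` is built as a Brown–Resnick process for the variogram `γ`: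
`Z(t) = max_i (X_i + W_i(t) - σ²(t) / 2)`, where the `W_i` are i.i.d. path-continuous,
intrinsically stationary, centred Gaussian fields with variogram `γ` and variance function `σ²`,
and `∑ δ_{X_i}` is an independent Poisson point process with intensity `e^{-x} dx`.
(Almost surely the supremum below is finite and attained.) -/
def IsBrownResnickProcess (γ : (Fin d → ℝ) → ℝ) (Z : (Fin d → ℝ) → Ω → ℝ)
    (P : Measure Ω) : Prop :=
  ∃ (X : ℕ → Ω → ℝ) (W : ℕ → (Fin d → ℝ) → Ω → ℝ),
    IsIntrinsicGaussianField (W 0) P ∧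
    variogram (W 0) P = γ ∧
    AreIndepCopies W P (W 0) P ∧
    (∀ i, Measurable (X i)) ∧
    IsPoissonPointProcess (pointMeasure X) expIntensity P ∧
    IndepFun (fun ω i => X i ω) (fun ω i t => W i t ω) P ∧
    ∀ t ω, Z t ω = ⨆ i, (X i ω + W i t ω - variance (W 0 t) P / 2)

/-- The point `inf (argsup f)`: the coordinatewise infimum of the set of points at which `f`
attains its supremum. -/
def infArgsup (f : (Fin d → ℝ) → ℝ) : Fin d → ℝ :=
  sInf {t | ∀ s, f s ≤ f t}

/-- The half-open box `(-mp/2, mp/2]` in `ℝ^d`. -/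
def centredBox (m : ℕ) (p : Fin d → ℝ) : Set (Fin d → ℝ) :=
  Set.univ.pi fun k => Set.Ioc (-(m * p k / 2)) (m * p k / 2)

/-- The lattice point `p · j` (coordinatewise product). -/
def latticePoint (p : Fin d → ℝ) (j : Fin d → ℤ) : Fin d → ℝ :=
  fun k => p k * j k

/-- The values `X_i^{(j)} + W_i^{(j)}(t - p·j) - σ²(t - p·j) / 2` over all `j ∈ ℤ^d` and all `i`
such that `T_i^{(j)} = inf (argsup (W_i^{(j)} - σ²/2))` lies in `(-mp/2, mp/2]`. -/
def shiftedValues (X : (Fin d → ℤ) → ℕ → Ω → ℝ)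
    (W : (Fin d → ℤ) → ℕ → (Fin d → ℝ) → Ω → ℝ) (σ2 : (Fin d → ℝ) → ℝ)
    (m : ℕ) (p : Fin d → ℝ) (t : Fin d → ℝ) (ω : Ω) : Set ℝ :=
  {x | ∃ (j : Fin d → ℤ) (i : ℕ),
    infArgsup (fun s => W j i s ω - σ2 s / 2) ∈ centredBox m p ∧
    x = X j i ω + W j i (t - latticePoint p j) ω - σ2 (t - latticePoint p j) / 2}

/-- The field `Z₃`: the maximum of `shiftedValues`. -/
def Z3 (X : (Fin d → ℤ) → ℕ → Ω → ℝ)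
    (W : (Fin d → ℤ) → ℕ → (Fin d → ℝ) → Ω → ℝ) (σ2 : (Fin d → ℝ) → ℝ)
    (m : ℕ) (p : Fin d → ℝ) (t : Fin d → ℝ) (ω : Ω) : ℝ :=
  sSup (shiftedValues X W σ2 m p t ω)

end BrownResnick

end

noncomputable section

/-! ### The decreasing exponential on `[0, ∞]` -/

/-! A maximum over independently marked Poisson points stays below `y` on a finite set `I` exactly
when no path lies in `{f | ∃ t ∈ I, y t < f t}`. The probability of this is `exp(-Λ)`, with `Λ` the
total intensity of that set (`measure_forall_notMem`). So two such fields have the same law once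
their path intensities agree.

For a Brown–Resnick process the path intensity is `exponentMeasure`, the image of `e^{-x} dx ⊗ P`
under `x + W - σ²/2`. It depends on the variogram only and is translation invariant
(`exponentMeasure_eq`): absorbing the value at `u` into `x` tilts `P` by `exp(W(u) - σ²(u)/2)`, and
under the tilted measure the increments from `u` have exponential moments in which only the
variogram occurs.

For `Z3`, shifting by `p·j` a path whose maximiser lies in the box `(-mp/2, mp/2]` moves the
maximiser into the translated box. By translation invariance, the `j`-th family therefore
contributes `m^{-d}` times `exponentMeasure` restricted to paths peaking in that translated box. The
translates cover every point exactly `m ^ d` times, so the contributions add up to `exponentMeasure`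
(`tsum_prod_pathSet`).

Fields live on the product `σ`-algebra, so events about maximisers are encoded through a dense
sequence (`argsupIn`, `vanishingPaths`). -/

/-- The function `t ↦ e^{-t}` on `[0, ∞]`, with value `0` at `∞`. -/
def expNeg (t : ENNReal) : ENNReal := EReal.exp (-(t : EReal))

lemma continuous_expNeg : Continuous expNeg :=
  ENNReal.continuous_exp.comp (continuous_neg.comp continuous_coe_ennreal_ereal)

lemma measurable_expNeg : Measurable expNeg := continuous_expNeg.measurable

@[simp] lemma expNeg_zero : expNeg 0 = 1 := by simp [expNeg]

@[simp] lemma expNeg_top : expNeg ⊤ = 0 := by simp [expNeg]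

lemma expNeg_le_one (t : ENNReal) : expNeg t ≤ 1 := by
  simp only [expNeg, EReal.exp_le_one_iff]
  rw [EReal.neg_le, neg_zero]
  exact EReal.coe_ennreal_nonneg t

lemma expNeg_eq_one_iff {t : ENNReal} : expNeg t = 1 ↔ t = 0 := by
  refine ⟨fun h => ?_, fun h => by simp [h]⟩
  have h1 := ENNReal.log_strictMono.injective.eq_iff.2 h
  simpa [expNeg] using h1

lemma expNeg_ofReal {r : ℝ} (hr : 0 ≤ r) :
    expNeg (ENNReal.ofReal r) = ENNReal.ofReal (Real.exp (-r)) := by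
  rw [expNeg, EReal.coe_ennreal_ofReal, max_eq_left hr, ← EReal.coe_neg, EReal.exp_coe]

lemma expNeg_add (s t : ENNReal) : expNeg (s + t) = expNeg s * expNeg t := by
  rw [expNeg, expNeg, expNeg, ← EReal.exp_add, EReal.coe_ennreal_add, EReal.neg_add, sub_eq_add_neg]
  · left; simp
  · right; simp

lemma expNeg_sum {ι : Type*} (s : Finset ι) (f : ι → ENNReal) :
    expNeg (∑ i ∈ s, f i) = ∏ i ∈ s, expNeg (f i) := by
  classical
  induction s using Finset.induction_on with
  | empty => simp
  | insert a s ha ih => rw [Finset.sum_insert ha, Finset.prod_insert ha, expNeg_add, ih]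

lemma expNeg_mul_nat (a : ENNReal) (n : ℕ) : expNeg (a * n) = expNeg a ^ n := by
  have := expNeg_sum (Finset.range n) fun _ => a
  simpa [mul_comm] using this

/-- The inverse of `expNeg` on `[0, 1]`. -/
def negLog (x : ENNReal) : ENNReal := (-(ENNReal.log x)).toENNReal

lemma measurable_negLog : Measurable negLog :=
  (EReal.continuous_toENNReal.comp (continuous_neg.comp ENNReal.continuous_log)).measurable

lemma expNeg_negLog {x : ENNReal} (hx : x ≤ 1) : expNeg (negLog x) = x := by
  rw [expNeg, negLog, EReal.coe_toENNReal, neg_neg, ENNReal.exp_log]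
  rw [EReal.le_neg, neg_zero]
  simpa using hx

/-! ### The Poisson distribution -/

lemma lintegral_poissonMeasure (r : NNReal) (f : ℕ → ENNReal) :
    ∫⁻ n, f n ∂poissonMeasure r =
      ∑' n : ℕ, ENNReal.ofReal (Real.exp (-r) * r ^ n / n.factorial) * f n := by
  rw [lintegral_countable']
  exact tsum_congr fun n => by rw [poissonMeasure_singleton, mul_comm]

/-- The Poisson generating function at `e^{-a}`, summed by the exponential series. The convention `0
* ∞ = 0` makes it hold for all `a` and `r` in `[0, ∞]`, so infinite weights and infinite intensities
need no separate treatment later. -/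
lemma lintegral_expNeg_extPoisson (a r : ENNReal) :
    ∫⁻ n, expNeg (a * n) ∂extPoisson r = expNeg ((1 - expNeg a) * r) := by
  unfold extPoisson
  split_ifs with hr
  · subst hr
    rw [lintegral_dirac]
    by_cases ha : a = 0
    · simp [ha]
    · rw [ENNReal.mul_top ha, ENNReal.mul_top]
      rw [Ne, tsub_eq_zero_iff_le, not_le]
      exact lt_of_le_of_ne (expNeg_le_one a) fun h => ha (expNeg_eq_one_iff.1 h)
  · rw [lintegral_map (f := fun n => expNeg (a * n))
      (measurable_expNeg.comp (measurable_const.mul measurable_id))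
      measurable_from_nat, lintegral_poissonMeasure]
    lift r to NNReal using hr
    obtain ⟨s, hs⟩ : ∃ s : NNReal, expNeg a = s :=
      ⟨(expNeg a).toNNReal, (ENNReal.coe_toNNReal
        ((expNeg_le_one a).trans_lt ENNReal.one_lt_top).ne).symm⟩
    have hs1 : (s : ℝ) ≤ 1 := by
      have := expNeg_le_one a
      rw [hs] at this
      exact_mod_cast this
    have h1 : (1 - (s : ENNReal)) * (r : ENNReal) = ENNReal.ofReal ((1 - s) * r) := by
      rw [ENNReal.ofReal_mul (by linarith), ENNReal.ofReal_sub _ s.coe_nonneg]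
      simp
    simp_rw [expNeg_mul_nat, hs, ENNReal.toNNReal_coe]
    rw [h1, expNeg_ofReal (mul_nonneg (by linarith) r.coe_nonneg)]
    have h2 : HasSum (fun n : ℕ => Real.exp (-r) * (((r : ℝ) * s) ^ n / n.factorial))
        (Real.exp (-r) * Real.exp (r * s)) := by
      have := NormedSpace.expSeries_div_hasSum_exp ((r : ℝ) * s)
      rw [← Real.exp_eq_exp_ℝ] at this
      exact this.mul_left _
    rw [← Real.exp_add] at h2
    have h3 : -((1 - (s : ℝ)) * r) = -r + r * s := by ring
    rw [h3, ← h2.tsum_eq, ENNReal.ofReal_tsum_of_nonneg _ h2.summable]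
    · refine tsum_congr fun n => ?_
      rw [← ENNReal.coe_pow, ← ENNReal.ofReal_coe_nnreal (p := s ^ n),
        ← ENNReal.ofReal_mul (by positivity)]
      congr 1
      push_cast
      ring
    · intro n; positivity

lemma lintegral_id_extPoisson (r : ENNReal) : ∫⁻ n, n ∂extPoisson r = r := by
  unfold extPoisson
  split_ifs with hr
  · rw [lintegral_dirac, hr]
  · rw [lintegral_map (f := fun n => n) measurable_id measurable_from_nat, lintegral_poissonMeasure]
    lift r to NNReal using hr
    have h2 := (hasSum_one_poissonMeasure r).mul_left (r : ℝ)
    rw [tsum_eq_zero_add' ENNReal.summable]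
    simp only [Nat.cast_zero, mul_zero, zero_add, ENNReal.toNNReal_coe]
    conv_rhs => rw [← ENNReal.ofReal_coe_nnreal, ← mul_one (r : ℝ), ← h2.tsum_eq]
    rw [ENNReal.ofReal_tsum_of_nonneg _ h2.summable]
    · refine tsum_congr fun n => ?_
      rw [← ENNReal.ofReal_natCast, ← ENNReal.ofReal_mul (by positivity)]
      congr 1
      rw [Nat.factorial_succ]
      push_cast
      have : (n.factorial : ℝ) ≠ 0 := by positivity
      field_simp
      ring
    · intro n; positivity

/-! ### Laplace functional and intensity of a Poisson point process -/

section PoissonProcess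

variable {Ω S : Type*} [MeasurableSpace Ω] [MeasurableSpace S] {P : Measure Ω}
  {N : Ω → Measure S} {μ : Measure S}

/-- The fibres of `φ` are finitely many disjoint sets, so their counts are independent and Poisson,
and the Laplace functional factorises. -/
lemma IsPoissonPointProcess.lintegral_expNeg_simpleFunc [IsProbabilityMeasure P]
    (hN : IsPoissonPointProcess N μ P) (φ : SimpleFunc S ENNReal) :
    ∫⁻ ω, expNeg (∫⁻ x, φ x ∂N ω) ∂P = expNeg (∫⁻ x, (1 - expNeg (φ x)) ∂μ) := by
  classical
  let e := Fintype.equivFin φ.range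
  let A : Fin (Fintype.card φ.range) → Set S := fun k => φ ⁻¹' {(e.symm k : ENNReal)}
  have hA : ∀ k, MeasurableSet (A k) := fun k => φ.measurableSet_fiber _
  have hdisj : Pairwise (Function.onFun Disjoint A) := by
    intro k l hkl
    refine Disjoint.preimage _ ?_
    rw [Set.disjoint_singleton]
    exact fun h => hkl (e.symm.injective (Subtype.ext h))
  have hNA : ∀ k, Measurable fun ω => N ω (A k) := fun k =>
    (Measure.measurable_coe (hA k)).comp hN.measurable
  have hsum : ∀ (g : ENNReal → ENNReal) (ν : Measure S),
      ∫⁻ x, g (φ x) ∂ν = ∑ k, g (e.symm k) * ν (A k) := by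
    intro g ν
    have : ∫⁻ x, g (φ x) ∂ν = (φ.map g).lintegral ν := by
      rw [← SimpleFunc.lintegral_eq_lintegral]; rfl
    rw [this, SimpleFunc.map_lintegral, ← Finset.sum_coe_sort]
    exact (Equiv.sum_comp e.symm fun y : φ.range => g y * ν (φ ⁻¹' {(y : ENNReal)})).symm
  have hind := (hN.indep _ A hA hdisj).comp (fun k n => expNeg (e.symm k * n))
    fun k => measurable_expNeg.comp (measurable_const.mul measurable_id)
  have hmeas : ∀ k, Measurable ((fun n => expNeg (e.symm k * n)) ∘ fun ω => N ω (A k)) := fun k =>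
    (measurable_expNeg.comp (measurable_const.mul measurable_id)).comp (hNA k)
  have h1 := lintegral_prod_eq_prod_lintegral_of_indepFun Finset.univ _ hind hmeas
  have h2 : ∀ ω, expNeg (∫⁻ x, φ x ∂N ω) =
      ∏ k, ((fun n => expNeg (e.symm k * n)) ∘ fun ω => N ω (A k)) ω := by
    intro ω
    rw [hsum (fun y => y) (N ω), expNeg_sum]
    rfl
  simp_rw [h2]
  rw [h1, hsum (fun y => 1 - expNeg y) μ, expNeg_sum]
  refine Finset.prod_congr rfl fun k _ => ?_
  rw [← lintegral_expNeg_extPoisson, ← (hN.hasLaw (A k) (hA k)).map_eq,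
    lintegral_map (f := fun n => expNeg (e.symm k * n))
      (measurable_expNeg.comp (measurable_const.mul measurable_id)) (hNA k)]
  rfl

lemma tendsto_lintegral_eapprox {φ : S → ENNReal} (hφ : Measurable φ) (ν : Measure S) :
    Tendsto (fun n => ∫⁻ x, SimpleFunc.eapprox φ n x ∂ν) atTop (𝓝 (∫⁻ x, φ x ∂ν)) :=
  lintegral_tendsto_of_tendsto_of_monotone
    (fun n => (SimpleFunc.eapprox φ n).measurable.aemeasurable)
    (ae_of_all _ fun x _ _ h => SimpleFunc.monotone_eapprox φ h x)
    (ae_of_all _ fun x => SimpleFunc.tendsto_eapprox hφ x)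

/-- The Laplace functional of a Poisson point process. -/
theorem IsPoissonPointProcess.lintegral_expNeg [IsProbabilityMeasure P]
    (hN : IsPoissonPointProcess N μ P) {φ : S → ENNReal} (hφ : Measurable φ) :
    ∫⁻ ω, expNeg (∫⁻ x, φ x ∂N ω) ∂P = expNeg (∫⁻ x, (1 - expNeg (φ x)) ∂μ) := by
  have hm : ∀ {ψ : S → ENNReal}, Measurable ψ →
      Measurable fun ω => expNeg (∫⁻ x, ψ x ∂N ω) := fun h =>
    measurable_expNeg.comp ((Measure.measurable_lintegral h).comp hN.measurable)
  have h1 : Tendsto (fun n => ∫⁻ ω, expNeg (∫⁻ x, SimpleFunc.eapprox φ n x ∂N ω) ∂P) atTop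
      (𝓝 (∫⁻ ω, expNeg (∫⁻ x, φ x ∂N ω) ∂P)) := by
    refine tendsto_lintegral_of_dominated_convergence (fun _ => 1)
      (fun n => hm (SimpleFunc.measurable _)) (fun n => ae_of_all _ fun ω => expNeg_le_one _)
      (by simp) (ae_of_all _ fun ω => ?_)
    exact (continuous_expNeg.tendsto _).comp (tendsto_lintegral_eapprox hφ (N ω))
  have h2 : Tendsto (fun n => expNeg (∫⁻ x, (1 - expNeg (SimpleFunc.eapprox φ n x)) ∂μ)) atTop
      (𝓝 (expNeg (∫⁻ x, (1 - expNeg (φ x)) ∂μ))) := by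
    refine (continuous_expNeg.tendsto _).comp ?_
    -- Monotone rather than dominated convergence, because `μ` may be infinite.
    refine lintegral_tendsto_of_tendsto_of_monotone
      (fun n => (measurable_const.sub
        (measurable_expNeg.comp (SimpleFunc.measurable _))).aemeasurable)
      (ae_of_all _ fun x m n h => ?_) (ae_of_all _ fun x => ?_)
    · refine tsub_le_tsub_left ?_ _
      refine EReal.exp_monotone (EReal.neg_le_neg_iff.2 ?_)
      exact_mod_cast SimpleFunc.monotone_eapprox φ h x
    · refine ENNReal.Tendsto.sub tendsto_const_nhds ?_ (Or.inl ENNReal.one_ne_top)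
      exact (continuous_expNeg.tendsto _).comp (SimpleFunc.tendsto_eapprox hφ x)
  refine tendsto_nhds_unique h1 (h2.congr fun n => ?_)
  rw [hN.lintegral_expNeg_simpleFunc]

/-- Campbell's formula for a Poisson point process. -/
theorem IsPoissonPointProcess.lintegral_lintegral [IsProbabilityMeasure P]
    (hN : IsPoissonPointProcess N μ P) {φ : S → ENNReal} (hφ : Measurable φ) :
    ∫⁻ ω, ∫⁻ x, φ x ∂N ω ∂P = ∫⁻ x, φ x ∂μ := by
  -- The mean measure of `N` is `μ`, as a Poisson variable has its parameter as mean.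
  have h : P.bind N = μ := by
    ext A hA
    rw [Measure.bind_apply hA hN.measurable.aemeasurable, ← lintegral_id_extPoisson (μ A),
      ← (hN.hasLaw A hA).map_eq, lintegral_map (f := fun n => n)
        (g := fun ω => N ω A) measurable_id ((Measure.measurable_coe hA).comp hN.measurable)]
  rw [← h, Measure.lintegral_bind hN.measurable.aemeasurable hφ.aemeasurable]

omit [MeasurableSpace Ω] in
lemma lintegral_pointMeasure (X : ℕ → Ω → S) (ω : Ω) {φ : S → ENNReal} (hφ : Measurable φ) :
    ∫⁻ x, φ x ∂pointMeasure X ω = ∑' i, φ (X i ω) := by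
  rw [pointMeasure, lintegral_sum_measure]
  exact tsum_congr fun i => lintegral_dirac' _ hφ

end PoissonProcess

/-! ### Independently marked Poisson point processes -/

section Marked

/-- Independent Poisson point processes `∑ i, δ_{X j i}`, `j ∈ J`, with intensity `μ`, and an
independent family of i.i.d. marks `V j i` with law `ν`. -/
structure IsMarkedPoissonFamily {J Ω S E : Type*} [MeasurableSpace Ω] [MeasurableSpace S]
    [MeasurableSpace E] (X : J → ℕ → Ω → S) (V : J → ℕ → Ω → E) (μ : Measure S) (ν : Measure E)
    (P : Measure Ω) : Prop where
  measurable_point : ∀ j i, Measurable (X j i)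
  measurable_mark : ∀ j i, Measurable (V j i)
  poisson : ∀ j, IsPoissonPointProcess (pointMeasure (X j)) μ P
  indep_poisson : iIndepFun (fun j => pointMeasure (X j)) P
  map_mark : ∀ j i, P.map (V j i) = ν
  indep_mark : iIndepFun (fun q : J × ℕ => V q.1 q.2) P
  indep : IndepFun (fun ω j i => X j i ω) (fun ω j i => V j i ω) P

variable {J Ω S E : Type*} [MeasurableSpace Ω] [MeasurableSpace S] [MeasurableSpace E]
  {X : J → ℕ → Ω → S} {V : J → ℕ → Ω → E} {μ : Measure S} {ν : Measure E} {P : Measure Ω}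

lemma measurable_measure_section [SFinite ν] {B : Set (S × E)} (hB : MeasurableSet B) :
    Measurable fun x => ν {v | (x, v) ∈ B} :=
  measurable_measure_prodMk_left hB

namespace IsMarkedPoissonFamily

/-- Fubini for the joint law of points and marks: the points may be frozen while only the marks stay
random. -/
lemma measure_eq_lintegral [IsProbabilityMeasure P] (h : IsMarkedPoissonFamily X V μ ν P)
    {A : Set ((J → ℕ → S) × (J → ℕ → E))} (hA : MeasurableSet A) :
    P {ω | (fun j i => X j i ω, fun j i => V j i ω) ∈ A} =
      ∫⁻ ω, P {ω' | (fun j i => X j i ω, fun j i => V j i ω') ∈ A} ∂P := by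
  have hX : Measurable fun ω j i => X j i ω :=
    measurable_pi_lambda _ fun j => measurable_pi_lambda _ fun i => h.measurable_point j i
  have hV : Measurable fun ω j i => V j i ω :=
    measurable_pi_lambda _ fun j => measurable_pi_lambda _ fun i => h.measurable_mark j i
  have hmap := (indepFun_iff_map_prod_eq_prod_map_map hX.aemeasurable hV.aemeasurable).1 h.indep
  have := Measure.isProbabilityMeasure_map hV.aemeasurable (μ := P)
  calc _ = P.map (fun ω => (fun j i => X j i ω, fun j i => V j i ω)) A := by
        rw [Measure.map_apply (hX.prodMk hV) hA]; rfl
    _ = _ := by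
        rw [hmap, Measure.prod_apply hA, lintegral_map (measurable_measure_prodMk_left hA) hX]
        refine lintegral_congr fun ω => ?_
        rw [Measure.map_apply hV (measurable_prodMk_left hA)]
        rfl

lemma measure_mark [IsProbabilityMeasure P] (h : IsMarkedPoissonFamily X V μ ν P)
    {B : Set E} (hB : MeasurableSet B) (j : J) (i : ℕ) : P {ω | V j i ω ∈ B} = ν B := by
  rw [← h.map_mark j i, Measure.map_apply (h.measurable_mark j i) hB]
  rfl

lemma measure_finset [IsProbabilityMeasure P] (h : IsMarkedPoissonFamily X V μ ν P)
    {B : J → Set (S × E)} (hB : ∀ j, MeasurableSet (B j)) (s : Finset (J × ℕ)) :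
    P {ω | ∀ q ∈ s, (X q.1 q.2 ω, V q.1 q.2 ω) ∉ B q.1} =
      ∫⁻ ω, ∏ q ∈ s, ν {v | (X q.1 q.2 ω, v) ∉ B q.1} ∂P := by
  have hA : MeasurableSet {z : (J → ℕ → S) × (J → ℕ → E) |
      ∀ q ∈ s, (z.1 q.1 q.2, z.2 q.1 q.2) ∉ B q.1} := by
    have : {z : (J → ℕ → S) × (J → ℕ → E) | ∀ q ∈ s, (z.1 q.1 q.2, z.2 q.1 q.2) ∉ B q.1} =
        ⋂ q ∈ s, {z | (z.1 q.1 q.2, z.2 q.1 q.2) ∈ (B q.1)ᶜ} := by ext; simp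
    rw [this]
    refine Finset.measurableSet_biInter s fun q _ => ?_
    exact (by fun_prop : Measurable fun z : (J → ℕ → S) × (J → ℕ → E) =>
      (z.1 q.1 q.2, z.2 q.1 q.2)) (hB q.1).compl
  refine (h.measure_eq_lintegral hA).trans (lintegral_congr fun ω => ?_)
  have hm : ∀ q : J × ℕ, MeasurableSet {v | (X q.1 q.2 ω, v) ∉ B q.1} := fun q =>
    (measurable_prodMk_left (hB q.1)).compl
  have h1 := h.indep_mark.measure_inter_preimage_eq_mul s (fun q _ => hm q)
  have h2 : {ω' | (fun j i => X j i ω, fun j i => V j i ω') ∈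
      {z : (J → ℕ → S) × (J → ℕ → E) | ∀ q ∈ s, (z.1 q.1 q.2, z.2 q.1 q.2) ∉ B q.1}} =
      ⋂ q ∈ s, (fun ω' => V q.1 q.2 ω') ⁻¹' {v | (X q.1 q.2 ω, v) ∉ B q.1} := by ext; simp
  rw [h2, h1]
  exact Finset.prod_congr rfl fun q _ => h.measure_mark (hm q) q.1 q.2

/-- Laplace functionals of independent processes multiply over finite sets of `j`; continuity of
`expNeg` on `[0, ∞]` gives the limit, even if the sums diverge. -/
lemma lintegral_expNeg_tsum [IsProbabilityMeasure P] [Countable J]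
    (h : IsMarkedPoissonFamily X V μ ν P) {φ : J → S → ENNReal} (hφ : ∀ j, Measurable (φ j)) :
    ∫⁻ ω, expNeg (∑' q : J × ℕ, φ q.1 (X q.1 q.2 ω)) ∂P =
      expNeg (∑' j, ∫⁻ x, (1 - expNeg (φ j x)) ∂μ) := by
  have hm : ∀ j, Measurable fun N : Measure S => expNeg (∫⁻ x, φ j x ∂N) := fun j =>
    measurable_expNeg.comp (Measure.measurable_lintegral (hφ j))
  have hm' : ∀ j, Measurable fun ω => expNeg (∫⁻ x, φ j x ∂pointMeasure (X j) ω) := fun j =>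
    (hm j).comp (h.poisson j).measurable
  have h1 : ∀ ω, ∑' q : J × ℕ, φ q.1 (X q.1 q.2 ω) = ∑' j, ∫⁻ x, φ j x ∂pointMeasure (X j) ω := by
    intro ω
    rw [ENNReal.tsum_prod (f := fun j i => φ j (X j i ω))]
    exact tsum_congr fun j => (lintegral_pointMeasure (X j) ω (hφ j)).symm
  simp_rw [h1]
  have h2 : ∀ s : Finset J, ∫⁻ ω, expNeg (∑ j ∈ s, ∫⁻ x, φ j x ∂pointMeasure (X j) ω) ∂P =
      expNeg (∑ j ∈ s, ∫⁻ x, (1 - expNeg (φ j x)) ∂μ) := by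
    intro s
    simp_rw [expNeg_sum]
    rw [lintegral_prod_eq_prod_lintegral_of_indepFun s
      (fun j ω => expNeg (∫⁻ x, φ j x ∂pointMeasure (X j) ω))
      (h.indep_poisson.comp (fun j N => expNeg (∫⁻ x, φ j x ∂N)) hm) hm']
    exact Finset.prod_congr rfl fun j _ => (h.poisson j).lintegral_expNeg (hφ j)
  have h3 : Tendsto (fun s : Finset J =>
      ∫⁻ ω, expNeg (∑ j ∈ s, ∫⁻ x, φ j x ∂pointMeasure (X j) ω) ∂P) atTop
      (𝓝 (∫⁻ ω, expNeg (∑' j, ∫⁻ x, φ j x ∂pointMeasure (X j) ω) ∂P)) := by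
    refine tendsto_lintegral_filter_of_dominated_convergence (fun _ => 1)
      (Eventually.of_forall fun s => ?_) (Eventually.of_forall fun s => ae_of_all _ fun ω =>
        expNeg_le_one _) (by simp) (ae_of_all _ fun ω => ?_)
    · simp_rw [expNeg_sum]
      exact Finset.measurable_prod s fun j _ => hm' j
    · exact (continuous_expNeg.tendsto _).comp ENNReal.summable.hasSum
  refine tendsto_nhds_unique h3 ?_
  simp_rw [h2]
  exact (continuous_expNeg.tendsto _).comp ENNReal.summable.hasSum

/-- The probability that no marked point lies in the forbidden sets. -/
theorem measure_forall_notMem [IsProbabilityMeasure P] [IsProbabilityMeasure ν] [Countable J]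
    (h : IsMarkedPoissonFamily X V μ ν P) {B : J → Set (S × E)} (hB : ∀ j, MeasurableSet (B j)) :
    P {ω | ∀ j i, (X j i ω, V j i ω) ∉ B j} = expNeg (∑' j, (μ.prod ν) (B j)) := by
  have hF : ∀ j, Measurable fun x => ν {v | (x, v) ∉ B j} := fun j =>
    measurable_measure_section (hB j).compl
  -- A frozen point `x` avoids `B j` with probability `ν {v | (x, v) ∉ B j}`. The product of these
  -- over all points is a Laplace functional with `φ` minus their logarithm, and `1 - e^{-φ}` is
  -- then the `ν`-measure of the section of `B j`.
  have h1 : ∀ j, (μ.prod ν) (B j) =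
      ∫⁻ x, (1 - expNeg (negLog (ν {v | (x, v) ∉ B j}))) ∂μ := by
    intro j
    rw [Measure.prod_apply (hB j)]
    refine lintegral_congr fun x => ?_
    rw [expNeg_negLog prob_le_one, ← prob_compl_eq_one_sub]
    · congr 1
      ext v; simp
    · exact (measurable_prodMk_left (hB j)).compl
  simp_rw [h1]
  rw [← h.lintegral_expNeg_tsum (φ := fun j x => negLog (ν {v | (x, v) ∉ B j}))
    fun j => measurable_negLog.comp (hF j)]
  have h2 : Tendsto (fun s : Finset (J × ℕ) =>
      P {ω | ∀ q ∈ s, (X q.1 q.2 ω, V q.1 q.2 ω) ∉ B q.1}) atTop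
      (𝓝 (P {ω | ∀ j i, (X j i ω, V j i ω) ∉ B j})) := by
    have : {ω | ∀ j i, (X j i ω, V j i ω) ∉ B j} =
        ⋂ s : Finset (J × ℕ), {ω | ∀ q ∈ s, (X q.1 q.2 ω, V q.1 q.2 ω) ∉ B q.1} := by
      ext ω
      simp only [Set.mem_iInter, Set.mem_ofPred_eq]
      exact ⟨fun h s q _ => h _ _, fun h j i => h {(j, i)} (j, i) (by simp)⟩
    rw [this]
    refine tendsto_measure_iInter_atTop (fun s => ?_)
      (fun s t hst ω hω q hq => hω q (hst hq)) ⟨∅, measure_ne_top _ _⟩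
    have : {ω | ∀ q ∈ s, (X q.1 q.2 ω, V q.1 q.2 ω) ∉ B q.1} =
        ⋂ q ∈ s, {ω | (X q.1 q.2 ω, V q.1 q.2 ω) ∈ (B q.1)ᶜ} := by ext; simp
    rw [this]
    exact (Finset.measurableSet_biInter s fun q _ =>
      ((h.measurable_point _ _).prodMk (h.measurable_mark _ _)) (hB q.1).compl).nullMeasurableSet
  refine tendsto_nhds_unique h2 ?_
  simp_rw [h.measure_finset hB]
  have h3 : ∀ (s : Finset (J × ℕ)) ω, ∏ q ∈ s, ν {v | (X q.1 q.2 ω, v) ∉ B q.1} =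
      expNeg (∑ q ∈ s, negLog (ν {v | (X q.1 q.2 ω, v) ∉ B q.1})) := by
    intro s ω
    rw [expNeg_sum]
    exact Finset.prod_congr rfl fun q _ => (expNeg_negLog prob_le_one).symm
  refine tendsto_lintegral_filter_of_dominated_convergence (fun _ => 1)
      (Eventually.of_forall fun s => ?_) (Eventually.of_forall fun s => ae_of_all _ fun ω => ?_)
      (by simp) (ae_of_all _ fun ω => ?_)
  · exact Finset.measurable_prod s fun q _ => (hF q.1).comp (h.measurable_point _ _)
  · rw [h3]; exact expNeg_le_one _
  · simp_rw [h3]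
    exact (continuous_expNeg.tendsto _).comp ENNReal.summable.hasSum

/-- The expected number of marked points in given sets. -/
theorem tsum_measure_mem [IsProbabilityMeasure P] [IsProbabilityMeasure ν] [Countable J]
    (h : IsMarkedPoissonFamily X V μ ν P) {B : J → Set (S × E)} (hB : ∀ j, MeasurableSet (B j)) :
    ∑' q : J × ℕ, P {ω | (X q.1 q.2 ω, V q.1 q.2 ω) ∈ B q.1} = ∑' j, (μ.prod ν) (B j) := by
  have hF : ∀ j, Measurable fun x => ν {v | (x, v) ∈ B j} := fun j =>
    measurable_measure_section (hB j)
  rw [ENNReal.tsum_prod (f := fun j i => P {ω | (X j i ω, V j i ω) ∈ B j})]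
  refine tsum_congr fun j => ?_
  rw [Measure.prod_apply (hB j)]
  change _ = ∫⁻ x, ν {v | (x, v) ∈ B j} ∂μ
  rw [← (h.poisson j).lintegral_lintegral (hF j)]
  simp_rw [lintegral_pointMeasure (X j) _ (hF j)]
  rw [lintegral_tsum (f := fun i ω => ν {v | (X j i ω, v) ∈ B j}) fun i =>
    ((hF j).comp (h.measurable_point j i)).aemeasurable]
  refine tsum_congr fun i => ?_
  refine (h.measure_eq_lintegral (A := {z | (z.1 j i, z.2 j i) ∈ B j}) ?_).trans
    (lintegral_congr fun ω => ?_)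
  · exact (by fun_prop : Measurable fun z : (J → ℕ → S) × (J → ℕ → E) => (z.1 j i, z.2 j i)) (hB j)
  · exact h.measure_mark (measurable_prodMk_left (hB j)) j i

end IsMarkedPoissonFamily

end Marked

/-! ### Exponential moments of intrinsically stationary Gaussian fields -/

section Gaussian

variable {Ω Ω' : Type*} [MeasurableSpace Ω] [MeasurableSpace Ω'] {d : ℕ} {P : Measure Ω}
  {P' : Measure Ω'} {W : (Fin d → ℝ) → Ω → ℝ} {W' : (Fin d → ℝ) → Ω' → ℝ}

/-- The field `W(t) - σ²(t) / 2`. -/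
def driftedField (W : (Fin d → ℝ) → Ω → ℝ) (P : Measure Ω) (t : Fin d → ℝ) (ω : Ω) : ℝ :=
  W t ω - variance (W t) P / 2

namespace IsIntrinsicGaussianField

lemma isProbabilityMeasure (h : IsIntrinsicGaussianField W P) : IsProbabilityMeasure P :=
  h.gaussian.isProbabilityMeasure

lemma memLp_two (h : IsIntrinsicGaussianField W P) (t : Fin d → ℝ) : MemLp (W t) 2 P :=
  (h.gaussian.hasGaussianLaw_eval t).memLp_two

lemma measurable_driftedField (h : IsIntrinsicGaussianField W P) (t : Fin d → ℝ) :
    Measurable (driftedField W P t) :=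
  (h.measurable t).sub_const _

lemma variance_sub_eq (h : IsIntrinsicGaussianField W P) (x y : Fin d → ℝ) :
    variance (fun ω => W x ω - W y ω) P = 2 * variogram W P (x - y) := by
  have := h.isProbabilityMeasure
  -- The increment with lag `x - y` is compared at the base points `y` and `0`.
  have h1 := (h.intrinsic (x - y)).cov 0 y 0
  simp only [zero_add, add_sub_cancel] at h1
  have hm : ∀ s t, AEMeasurable (fun ω => W s ω - W t ω) P := fun s t =>
    ((h.measurable s).sub (h.measurable t)).aemeasurable
  rw [covariance_self (hm _ _), covariance_self (hm _ _)] at h1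
  rw [h1, variance_of_integral_eq_zero (hm _ _), variogram]
  · ring
  · rw [integral_sub ((h.memLp_two _).integrable one_le_two)
      ((h.memLp_two _).integrable one_le_two), h.mean_zero, h.mean_zero, sub_zero]

lemma covariance_eq (h : IsIntrinsicGaussianField W P) (x y : Fin d → ℝ) :
    covariance (W x) (W y) P =
      (variance (W x) P + variance (W y) P) / 2 - variogram W P (x - y) := by
  have := h.isProbabilityMeasure
  have h1 := h.variance_sub_eq x y
  rw [variance_fun_sub (h.memLp_two x) (h.memLp_two y)] at h1
  linarith

lemma variogram_zero : variogram W P 0 = 0 := by simp [variogram]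

/-- Exponential moments of affine combinations of the drifted field depend on the variogram
only. -/
lemma mgf_affine (h : IsIntrinsicGaussianField W P) {ι : Type*} [Fintype ι]
    (x : ι → Fin d → ℝ) (b : ι → ℝ) (hb : ∑ q, b q = 1) :
    mgf (fun ω => ∑ q, b q * driftedField W P (x q) ω) P 1 =
      Real.exp (-(∑ q, ∑ r, b q * b r * variogram W P (x q - x r)) / 2) := by
  have := h.isProbabilityMeasure
  have hL : ∀ q, MemLp (fun ω => b q * W (x q) ω) 2 P := fun q => (h.memLp_two (x q)).const_mul _
  have hG : HasGaussianLaw (fun ω => ∑ q, b q * W (x q) ω) P :=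
    ((h.gaussian.comp_right x).smul b).hasGaussianLaw_fun_sum (I := Finset.univ)
  have hmean : ∫ ω, ∑ q, b q * W (x q) ω ∂P = 0 := by
    rw [integral_finsetSum _ fun q _ => (hL q).integrable one_le_two]
    simp [integral_const_mul, h.mean_zero]
  -- Since the weights sum to one, the variances in the double sum collapse to `∑ b q σ²(x q)`; half
  -- of this is exactly what the drift removes, leaving only the variogram.
  have hvar : variance (fun ω => ∑ q, b q * W (x q) ω) P =
      ∑ q, b q * variance (W (x q)) P -
        ∑ q, ∑ r, b q * b r * variogram W P (x q - x r) := by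
    rw [variance_fun_sum hL]
    simp_rw [covariance_const_mul_left, covariance_const_mul_right, h.covariance_eq]
    have e : ∀ q r, b q * (b r * ((variance (W (x q)) P + variance (W (x r)) P) / 2 -
        variogram W P (x q - x r))) = b r * (b q * variance (W (x q)) P / 2) +
        b q * (b r * variance (W (x r)) P / 2) - b q * b r * variogram W P (x q - x r) := by
      intro q r; ring
    simp_rw [e, Finset.sum_sub_distrib, Finset.sum_add_distrib, ← Finset.mul_sum,
      ← Finset.sum_mul, hb]
    rw [one_mul, ← Finset.sum_add_distrib]
    congr 1
    exact Finset.sum_congr rfl fun q _ => by ring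
  have hsplit : (fun ω => ∑ q, b q * driftedField W P (x q) ω) = fun ω =>
      ∑ q, b q * W (x q) ω + -(∑ q, b q * variance (W (x q)) P) / 2 := by
    ext ω
    simp only [driftedField, mul_sub, Finset.sum_sub_distrib]
    rw [neg_div, Finset.sum_div, ← sub_eq_add_neg]
    congr 1
    exact Finset.sum_congr rfl fun q _ => by ring
  rw [hsplit, mgf_add_const, mgf_gaussianReal hG.map_eq_gaussianReal, hmean, hvar, ← Real.exp_add]
  rw [← hvar, Real.coe_toNNReal _ (variance_nonneg _ _), hvar]
  congr 1
  ring

lemma integrable_exp_affine (h : IsIntrinsicGaussianField W P) {ι : Type*} [Fintype ι]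
    (x : ι → Fin d → ℝ) (b : ι → ℝ) (hb : ∑ q, b q = 1) :
    Integrable (fun ω => Real.exp (∑ q, b q * driftedField W P (x q) ω)) P := by
  have := h.isProbabilityMeasure
  have h1 : 0 < mgf (fun ω => ∑ q, b q * driftedField W P (x q) ω) P 1 := by
    rw [h.mgf_affine x b hb]; exact Real.exp_pos _
  simpa using mgf_pos_iff.1 h1

lemma integrable_exp (h : IsIntrinsicGaussianField W P) (u : Fin d → ℝ) :
    Integrable (fun ω => Real.exp (driftedField W P u ω)) P := by
  simpa using h.integrable_exp_affine (fun _ : Unit => u) (fun _ => 1) (by simp)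

lemma lintegral_exp (h : IsIntrinsicGaussianField W P) (u : Fin d → ℝ) :
    ∫⁻ ω, ENNReal.ofReal (Real.exp (driftedField W P u ω)) ∂P = 1 := by
  rw [← ofReal_integral_eq_lintegral_ofReal (h.integrable_exp u)
    (ae_of_all _ fun ω => (Real.exp_pos _).le)]
  have := h.mgf_affine (fun _ : Unit => u) (fun _ => 1) (by simp)
  simp only [mgf, Finset.univ_unique, Finset.sum_const, Finset.card_singleton, one_mul, one_smul,
    sub_self, variogram_zero] at this
  simp [this]

/-- `E exp(iW(t)) = exp(-σ²(t)/2)`, and the left side is continuous by bounded convergence along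
continuous paths. -/
lemma continuous_variance (h : IsIntrinsicGaussianField W P) :
    Continuous fun t => variance (W t) P := by
  have := h.isProbabilityMeasure
  have h1 : ∀ t, ∫ ω, Complex.exp (W t ω * Complex.I) ∂P =
      (Real.exp (-variance (W t) P / 2) : ℂ) := by
    intro t
    have hG := (h.gaussian.hasGaussianLaw_eval t).map_eq_gaussianReal
    have h2 := charFun_apply_real (μ := P.map (W t)) 1
    rw [integral_map (h.measurable t).aemeasurable (by fun_prop), hG, charFun_gaussianReal,
      h.mean_zero, Real.coe_toNNReal _ (variance_nonneg _ _)] at h2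
    simp only [Complex.ofReal_one, one_mul] at h2
    rw [← h2]
    push_cast
    congr 1
    ring
  have h2 : Continuous fun t => ∫ ω, Complex.exp (W t ω * Complex.I) ∂P := by
    refine continuous_of_dominated (bound := fun _ => 1)
      (fun t => ?_) (fun t => ae_of_all _ fun ω => ?_) (integrable_const _)
      (ae_of_all _ fun ω => ?_)
    · have := h.measurable t
      exact Measurable.aestronglyMeasurable (by fun_prop)
    · rw [Complex.norm_exp_ofReal_mul_I]
    · have := h.continuous ω
      fun_prop
  simp_rw [h1] at h2
  have h3 : Continuous fun t => Real.exp (-variance (W t) P / 2) := by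
    have := Complex.continuous_re.comp h2
    simpa only [Function.comp_def, Complex.ofReal_re] using this
  have h4 := (h3.log fun t => (Real.exp_pos _).ne').const_mul (-2)
  simp only [Real.log_exp] at h4
  refine h4.congr fun t => by ring

lemma continuous_driftedField (h : IsIntrinsicGaussianField W P) (ω : Ω) :
    Continuous fun t => driftedField W P t ω :=
  (h.continuous ω).sub (h.continuous_variance.div_const 2)

end IsIntrinsicGaussianField

/-! ### The tilted increments -/

/-- Positivity encodes integrability, as `mgf` is `0` where the exponential is not integrable. With
all moments finite, the complex moment generating function is determined by its real values. -/
lemma Measure.ext_of_mgf_eq {μ ν : Measure ℝ} [IsProbabilityMeasure μ] [IsFiniteMeasure ν]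
    (hμ : ∀ t, 0 < mgf id μ t) (h : mgf id μ = mgf id ν) : μ = ν := by
  have huniv : integrableExpSet id μ = Set.univ := by
    exact Set.eq_univ_of_forall fun t => mgf_pos_iff.1 (hμ t)
  refine Measure.ext_of_complexMGF_id_eq ?_
  ext z
  refine eqOn_complexMGF_of_mgf h ?_
  simp [huniv]

/-- The measure with density `exp (W(u) - σ²(u) / 2)`. -/
def tiltedMeasure (W : (Fin d → ℝ) → Ω → ℝ) (P : Measure Ω) (u : Fin d → ℝ) : Measure Ω :=
  P.withDensity fun ω => ENNReal.ofReal (Real.exp (driftedField W P u ω))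

/-- The increments of the drifted field relative to the point `u`. -/
def driftedIncrement (W : (Fin d → ℝ) → Ω → ℝ) (P : Measure Ω) (u : Fin d → ℝ) (ω : Ω) :
    (Fin d → ℝ) → ℝ :=
  fun t => driftedField W P (u + t) ω - driftedField W P u ω

namespace IsIntrinsicGaussianField

lemma isProbabilityMeasure_tiltedMeasure (h : IsIntrinsicGaussianField W P) (u : Fin d → ℝ) :
    IsProbabilityMeasure (tiltedMeasure W P u) :=
  ⟨by rw [tiltedMeasure, withDensity_apply _ MeasurableSet.univ, Measure.restrict_univ,
    h.lintegral_exp u]⟩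

lemma measurable_driftedIncrement (h : IsIntrinsicGaussianField W P) (u : Fin d → ℝ) :
    Measurable (driftedIncrement W P u) :=
  measurable_pi_lambda _ fun _ => (h.measurable_driftedField _).sub (h.measurable_driftedField _)

/-- The density adds one factor at the base point `u`, indexed by `none`. Its weight `1 - ∑ k, s * a
k` brings the total to one, so `mgf_affine` applies; `u` cancels in the differences. -/
lemma mgf_driftedIncrement (h : IsIntrinsicGaussianField W P) (u : Fin d → ℝ) {ι : Type*}
    [Fintype ι] (x : ι → Fin d → ℝ) (a : ι → ℝ) (s : ℝ) :
    mgf (fun ω => ∑ q, a q * driftedIncrement W P u ω (x q)) (tiltedMeasure W P u) s =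
      Real.exp (-(∑ q : Option ι, ∑ r : Option ι,
        (q.elim (1 - ∑ k, s * a k) fun k => s * a k) *
        (r.elim (1 - ∑ k, s * a k) fun k => s * a k) *
        variogram W P (q.elim 0 x - r.elim 0 x)) / 2) := by
  have h1 := h.mgf_affine (ι := Option ι) (fun q => u + q.elim 0 x)
    (fun q => q.elim (1 - ∑ k, s * a k) fun k => s * a k) (by simp [Fintype.sum_option])
  simp only [add_sub_add_left_eq_sub] at h1
  rw [← h1, mgf, mgf, tiltedMeasure, integral_withDensity_eq_integral_toReal_smul
    (by have := h.measurable_driftedField u; fun_prop) (ae_of_all _ fun _ => ENNReal.ofReal_lt_top)]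
  refine integral_congr_ae (ae_of_all _ fun ω => ?_)
  simp only [smul_eq_mul, ENNReal.toReal_ofReal (Real.exp_pos _).le, ← Real.exp_add, one_mul]
  congr 1
  simp only [Fintype.sum_option, Option.elim, add_zero, driftedIncrement, mul_sub,
    Finset.sum_sub_distrib, sub_mul, Finset.sum_mul, Finset.mul_sum, one_mul, mul_assoc]
  ring

lemma mgf_map_restrict (h : IsIntrinsicGaussianField W P) (u : Fin d → ℝ)
    (I : Finset (Fin d → ℝ)) (L : (I → ℝ) →L[ℝ] ℝ) (s : ℝ) :
    mgf id ((((tiltedMeasure W P u).map (driftedIncrement W P u)).map I.restrict).map L) s =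
      mgf (fun ω => ∑ i : I, L (Pi.single i 1) * driftedIncrement W P u ω i)
        (tiltedMeasure W P u) s := by
  have hL : Measurable L := L.continuous.measurable
  have hr := Finset.measurable_restrict (X := fun _ : Fin d → ℝ => ℝ) I
  have hm := h.measurable_driftedIncrement u
  rw [Measure.map_map hL hr, Measure.map_map (hL.comp hr) hm,
    mgf_id_map ((hL.comp hr).comp hm).aemeasurable]
  congr 1
  ext ω
  have : I.restrict (driftedIncrement W P u ω) =
      ∑ i : I, driftedIncrement W P u ω i • (Pi.single i 1 : I → ℝ) := by
    ext k
    simp [Finset.sum_apply, Pi.single_apply]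
  simp only [Function.comp_apply]
  rw [this, map_sum]
  exact Finset.sum_congr rfl fun i _ => by rw [map_smul, smul_eq_mul, mul_comm]

/-- The law of the tilted increments depends on the variogram only. -/
theorem map_driftedIncrement_eq (h : IsIntrinsicGaussianField W P)
    (h' : IsIntrinsicGaussianField W' P') (hγ : variogram W P = variogram W' P')
    (u u' : Fin d → ℝ) :
    (tiltedMeasure W P u).map (driftedIncrement W P u) =
      (tiltedMeasure W' P' u').map (driftedIncrement W' P' u') := by
  have := h.isProbabilityMeasure_tiltedMeasure u
  have := h'.isProbabilityMeasure_tiltedMeasure u'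
  have hm := h.measurable_driftedIncrement u
  have hm' := h'.measurable_driftedIncrement u'
  have := Measure.isProbabilityMeasure_map hm.aemeasurable (μ := tiltedMeasure W P u)
  have := Measure.isProbabilityMeasure_map hm'.aemeasurable (μ := tiltedMeasure W' P' u')
  have hI : ∀ I : Finset (Fin d → ℝ), IsProbabilityMeasure
      (((tiltedMeasure W P u).map (driftedIncrement W P u)).map I.restrict) := fun I =>
    Measure.isProbabilityMeasure_map (Finset.measurable_restrict I).aemeasurable
  -- Finite-dimensional marginals determine the law, their linear functionals determine the
  -- marginals (Cramér–Wold), and the latter are identified by their exponential moments.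
  refine IsProjectiveLimit.unique (P := fun I : Finset (Fin d → ℝ) =>
    ((tiltedMeasure W P u).map (driftedIncrement W P u)).map I.restrict) (fun I => rfl)
    fun I => ?_
  refine (Measure.ext_of_charFunDual (funext fun L => ?_)).symm
  rw [charFunDual_eq_charFun_map_one, charFunDual_eq_charFun_map_one]
  have hL : Measurable L := L.continuous.measurable
  have := Measure.isProbabilityMeasure_map hL.aemeasurable
    (μ := ((tiltedMeasure W P u).map (driftedIncrement W P u)).map I.restrict)
  have hpos : ∀ s, 0 < mgf id ((((tiltedMeasure W P u).map (driftedIncrement W P u)).map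
      I.restrict).map L) s := fun s => by
    rw [h.mgf_map_restrict, h.mgf_driftedIncrement]
    exact Real.exp_pos _
  change charFun ((((tiltedMeasure W P u).map (driftedIncrement W P u)).map I.restrict).map L) 1 = _
  refine congrArg (fun μ => charFun μ 1) (Measure.ext_of_mgf_eq hpos (funext fun s => ?_))
  rw [h.mgf_map_restrict, h'.mgf_map_restrict, h.mgf_driftedIncrement, h'.mgf_driftedIncrement, hγ]

end IsIntrinsicGaussianField

end Gaussian

/-! ### The intensity measure of the Poisson process of paths -/

section ExponentMeasure

instance : SigmaFinite expIntensity := by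
  unfold expIntensity
  infer_instance

/-- The factor `e^c` is the source of the tilting density, with `c` the value of the drifted field
at the base point. -/
lemma expIntensity_preimage_add (c : ℝ) {A : Set ℝ} (hA : MeasurableSet A) :
    expIntensity {x | x + c ∈ A} = ENNReal.ofReal (Real.exp c) * expIntensity A := by
  have hA' : MeasurableSet {x : ℝ | x + c ∈ A} := measurable_add_const c hA
  rw [expIntensity, withDensity_apply _ hA', withDensity_apply _ hA, ← lintegral_indicator hA',
    ← lintegral_indicator hA, ← lintegral_add_right_eq_self (A.indicator fun x => ENNReal.ofReal (Real.exp (-x))) c,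
    ← lintegral_const_mul' _ _ ENNReal.ofReal_ne_top]
  refine lintegral_congr fun x => ?_
  by_cases hx : x + c ∈ A
  · rw [Set.indicator_of_mem (show x ∈ {x | x + c ∈ A} from hx), Set.indicator_of_mem hx,
      ← ENNReal.ofReal_mul (Real.exp_pos _).le, ← Real.exp_add]
    congr 2
    ring
  · rw [Set.indicator_of_notMem (show x ∉ {x | x + c ∈ A} from hx), Set.indicator_of_notMem hx,
      mul_zero]

lemma expIntensity_Ioi (a : ℝ) : expIntensity (Set.Ioi a) = ENNReal.ofReal (Real.exp (-a)) := by
  rw [expIntensity, withDensity_apply _ measurableSet_Ioi, ← integral_exp_neg_Ioi a,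
    ofReal_integral_eq_lintegral_ofReal (integrableOn_exp_neg_Ioi a)
      (ae_of_all _ fun x => (Real.exp_pos _).le)]

variable {Ω Ω' : Type*} [MeasurableSpace Ω] [MeasurableSpace Ω'] {d : ℕ} {P : Measure Ω}
  {P' : Measure Ω'} {W : (Fin d → ℝ) → Ω → ℝ} {W' : (Fin d → ℝ) → Ω' → ℝ}

/-- The image of `e^{-x} dx ⊗ P` under `(x, ω) ↦ x + Y(·, ω)`. -/
def exponentMeasure (Y : (Fin d → ℝ) → Ω → ℝ) (P : Measure Ω) : Measure ((Fin d → ℝ) → ℝ) :=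
  (expIntensity.prod P).map fun z t => z.1 + Y t z.2

lemma measurable_const_add_field {Y : (Fin d → ℝ) → Ω → ℝ} (hY : ∀ t, Measurable (Y t)) :
    Measurable fun (z : ℝ × Ω) t => z.1 + Y t z.2 :=
  measurable_pi_lambda _ fun t => measurable_fst.add ((hY t).comp measurable_snd)

lemma exponentMeasure_apply [SFinite P] {Y : (Fin d → ℝ) → Ω → ℝ} (hY : ∀ t, Measurable (Y t))
    {S : Set ((Fin d → ℝ) → ℝ)} (hS : MeasurableSet S) :
    exponentMeasure Y P S = ∫⁻ ω, expIntensity {x | (fun t => x + Y t ω) ∈ S} ∂P := by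
  have hm := measurable_const_add_field hY
  rw [exponentMeasure, Measure.map_apply hm hS, Measure.prod_apply_symm (hm hS)]
  rfl

/-- The path `x + Y(u + t)` equals `(x + Y(u)) + (Y(u + t) - Y(u))`; substituting `x + Y(u)` for the
variable costs the density `e^{Y(u)}`. -/
lemma IsIntrinsicGaussianField.exponentMeasure_shift_apply (h : IsIntrinsicGaussianField W P)
    (u : Fin d → ℝ) {S : Set ((Fin d → ℝ) → ℝ)} (hS : MeasurableSet S) :
    exponentMeasure (fun t => driftedField W P (u + t)) P S =
      ∫⁻ f, expIntensity {x | (fun t => x + f t) ∈ S}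
        ∂(tiltedMeasure W P u).map (driftedIncrement W P u) := by
  have := h.isProbabilityMeasure
  have hE : Measurable fun z : ℝ × ((Fin d → ℝ) → ℝ) => (fun t => z.1 + z.2 t) :=
    measurable_const_add_field fun t => measurable_pi_apply t
  have hH : Measurable fun f : (Fin d → ℝ) → ℝ => expIntensity {x | (fun t => x + f t) ∈ S} :=
    measurable_measure_prodMk_right (hE hS)
  have hH' : Measurable fun ω => expIntensity {x | (fun t => x + driftedIncrement W P u ω t) ∈ S} :=
    hH.comp (h.measurable_driftedIncrement u)
  rw [lintegral_map hH (h.measurable_driftedIncrement u), tiltedMeasure,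
    lintegral_withDensity_eq_lintegral_mul _
      (by have := h.measurable_driftedField u; fun_prop) hH',
    exponentMeasure_apply (fun t => h.measurable_driftedField _) hS]
  refine lintegral_congr fun ω => ?_
  have hA : MeasurableSet {x | (fun t => x + driftedIncrement W P u ω t) ∈ S} :=
    (measurable_pi_lambda _ fun t => measurable_id.add_const _) hS
  rw [Pi.mul_apply, ← expIntensity_preimage_add _ hA]
  congr 1
  ext x
  simp [driftedIncrement]

/-- The intensity measure of the path process is invariant under translations and depends on the
variogram only. -/
theorem IsIntrinsicGaussianField.exponentMeasure_eq (h : IsIntrinsicGaussianField W P)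
    (h' : IsIntrinsicGaussianField W' P') (hγ : variogram W P = variogram W' P')
    (u u' : Fin d → ℝ) :
    exponentMeasure (fun t => driftedField W P (u + t)) P =
      exponentMeasure (fun t => driftedField W' P' (u' + t)) P' := by
  ext S hS
  rw [h.exponentMeasure_shift_apply u hS, h'.exponentMeasure_shift_apply u' hS,
    h.map_driftedIncrement_eq h' hγ u u']

/-- Follows from `E e^{Y(t)} = 1`. Finiteness and divergence as `y → -∞` are what make the maxima
exist. -/
lemma IsIntrinsicGaussianField.exponentMeasure_lt (h : IsIntrinsicGaussianField W P)
    (t : Fin d → ℝ) (y : ℝ) :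
    exponentMeasure (driftedField W P) P {f | y < f t} = ENNReal.ofReal (Real.exp (-y)) := by
  have := h.isProbabilityMeasure
  rw [exponentMeasure_apply h.measurable_driftedField
    (measurableSet_lt measurable_const (measurable_pi_apply t))]
  have : ∀ ω, expIntensity {x | (fun t => x + driftedField W P t ω) ∈ {f | y < f t}} =
      ENNReal.ofReal (Real.exp (driftedField W P t ω)) * expIntensity (Set.Ioi y) := fun ω =>
    expIntensity_preimage_add _ measurableSet_Ioi
  simp_rw [this]
  rw [lintegral_mul_const _ (by have := h.measurable_driftedField t; fun_prop), h.lintegral_exp,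
    one_mul, expIntensity_Ioi]

end ExponentMeasure

/-! ### The maximisers of a path -/

section Argsup

variable {d : ℕ}

/-- The paths whose supremum is approximated on the half-space `{t | t k < a}`. -/
def supOnHalfspace (k : Fin d) (a : ℝ) : Set ((Fin d → ℝ) → ℝ) :=
  {f | ∀ n N : ℕ, ∃ l : ℕ, TopologicalSpace.denseSeq (Fin d → ℝ) l k < a ∧
    f (TopologicalSpace.denseSeq _ n) - 1 / (N + 1) < f (TopologicalSpace.denseSeq _ l)}

/-- The paths which tend to `-∞` along a dense sequence. -/
def vanishingPaths (d : ℕ) : Set ((Fin d → ℝ) → ℝ) :=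
  {f | ∀ N : ℕ, ∃ R : ℕ, ∀ n : ℕ, R < ‖TopologicalSpace.denseSeq (Fin d → ℝ) n‖ →
    f (TopologicalSpace.denseSeq _ n) ≤ -N}

lemma measurableSet_vanishingPaths : MeasurableSet (vanishingPaths d) := by
  have : vanishingPaths d = ⋂ N : ℕ, ⋃ R : ℕ, ⋂ n : ℕ,
      ⋂ (_ : R < ‖TopologicalSpace.denseSeq (Fin d → ℝ) n‖),
      {f : (Fin d → ℝ) → ℝ | f (TopologicalSpace.denseSeq _ n) ≤ -(N : ℝ)} := by
    ext f; simp [vanishingPaths]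
  rw [this]
  exact MeasurableSet.iInter fun N => MeasurableSet.iUnion fun R => MeasurableSet.iInter fun n =>
    MeasurableSet.iInter fun _ => measurableSet_le (measurable_pi_apply _) measurable_const

lemma measurableSet_supOnHalfspace (k : Fin d) (a : ℝ) : MeasurableSet (supOnHalfspace k a) := by
  have : supOnHalfspace k a = ⋂ n : ℕ, ⋂ N : ℕ, ⋃ l : ℕ,
      ⋃ (_ : TopologicalSpace.denseSeq (Fin d → ℝ) l k < a),
      {f : (Fin d → ℝ) → ℝ | f (TopologicalSpace.denseSeq _ n) - 1 / ((N : ℝ) + 1) <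
        f (TopologicalSpace.denseSeq _ l)} := by
    ext f; simp [supOnHalfspace]
  rw [this]
  exact MeasurableSet.iInter fun n => MeasurableSet.iInter fun N => MeasurableSet.iUnion fun l =>
    MeasurableSet.iUnion fun _ =>
      measurableSet_lt ((measurable_pi_apply _).sub_const _) (measurable_pi_apply _)

lemma const_add_mem_supOnHalfspace {k : Fin d} {a : ℝ} {f : (Fin d → ℝ) → ℝ} (c : ℝ) :
    (fun t => c + f t) ∈ supOnHalfspace k a ↔ f ∈ supOnHalfspace k a := by
  simp only [supOnHalfspace, Set.mem_ofPred_eq, add_sub_assoc, add_lt_add_iff_left]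

/-- Continuous paths tending to `-∞` at infinity. -/
structure IsVanishingPath (f : (Fin d → ℝ) → ℝ) : Prop where
  continuous : Continuous f
  tendsto : Tendsto f (Bornology.cobounded (Fin d → ℝ)) atBot

/-- Equality in law only sees measurable sets of paths; this lets decay at infinity pass from `W` to
its copies. -/
lemma mem_vanishingPaths_iff {f : (Fin d → ℝ) → ℝ} (hf : Continuous f) :
    f ∈ vanishingPaths d ↔ IsVanishingPath f := by
  constructor
  · refine fun h => ⟨hf, tendsto_atBot.2 fun b => ?_⟩
    obtain ⟨N, hN⟩ := exists_nat_ge (-b)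
    obtain ⟨R, hR⟩ := h N
    rw [← comap_norm_atTop]
    refine ⟨Set.Ioi (R : ℝ), Ioi_mem_atTop _, fun t ht => ?_⟩
    have hopen : IsOpen {t : Fin d → ℝ | (R : ℝ) < ‖t‖} :=
      isOpen_lt continuous_const continuous_norm
    have h1 : t ∈ closure ({t : Fin d → ℝ | (R : ℝ) < ‖t‖} ∩
        Set.range (TopologicalSpace.denseSeq (Fin d → ℝ))) :=
      (TopologicalSpace.denseRange_denseSeq (Fin d → ℝ)).open_subset_closure_inter hopen ht
    have h2 : closure ({t : Fin d → ℝ | (R : ℝ) < ‖t‖} ∩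
        Set.range (TopologicalSpace.denseSeq (Fin d → ℝ))) ⊆ {t | f t ≤ -N} := by
      refine closure_minimal ?_ (isClosed_le hf continuous_const)
      rintro _ ⟨hs, n, rfl⟩
      exact hR n hs
    have h3 : f t ≤ -N := h2 h1
    show f t ≤ b
    linarith
  · intro h N
    have h1 := (tendsto_atBot.1 h.tendsto) (-N)
    rw [← comap_norm_atTop] at h1
    obtain ⟨s, hs, hs'⟩ := h1
    obtain ⟨a, ha⟩ := mem_atTop_sets.1 hs
    obtain ⟨R, hR⟩ := exists_nat_ge a
    exact ⟨R, fun n hn => hs' (ha _ (hR.trans hn.le))⟩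

namespace IsVanishingPath

variable {f : (Fin d → ℝ) → ℝ}

lemma exists_isMaxOn (hf : IsVanishingPath f) {K : Set (Fin d → ℝ)} (hK : IsClosed K)
    (hne : K.Nonempty) : ∃ t ∈ K, ∀ s ∈ K, f s ≤ f t := by
  obtain ⟨t₀, ht₀⟩ := hne
  obtain ⟨t, ht, hmax⟩ := hf.continuous.continuousOn.exists_isMaxOn' hK ht₀ (by
    rw [← Metric.cobounded_eq_cocompact]
    exact (hf.tendsto.eventually (eventually_le_atBot (f t₀))).filter_mono inf_le_left)
  exact ⟨t, ht, fun s hs => hmax hs⟩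

lemma isCompact_argsup (hf : IsVanishingPath f) : IsCompact {t | ∀ s, f s ≤ f t} := by
  refine Metric.isCompact_of_isClosed_isBounded ?_ ?_
  · rw [Set.ofPred_forall]
    exact isClosed_iInter fun s => isClosed_le continuous_const hf.continuous
  · have h1 := hf.tendsto.eventually (eventually_lt_atBot (f 0))
    rw [← Bornology.isCobounded_compl_iff]
    exact mem_of_superset h1 fun t ht ht' => absurd (ht' 0) (not_le.2 ht)

/-- The set of maximisers is compact and nonempty, so each coordinate infimum is attained, possibly
at a different maximiser for each `k`. -/
lemma infArgsup_le_iff (hf : IsVanishingPath f) (k : Fin d) (a : ℝ) :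
    infArgsup f k ≤ a ↔ ∃ t, (∀ s, f s ≤ f t) ∧ t k ≤ a := by
  obtain ⟨t₁, -, ht₁⟩ := hf.exists_isMaxOn isClosed_univ Set.univ_nonempty
  obtain ⟨t₀, ht₀, hmin⟩ := hf.isCompact_argsup.exists_isMinOn ⟨t₁, fun s => ht₁ s trivial⟩
    (continuous_apply k).continuousOn
  have h : infArgsup f k = t₀ k := by
    rw [infArgsup, sInf_apply]
    have hlow : ∀ t : {t | ∀ s, f s ≤ f t}, t₀ k ≤ (t : Fin d → ℝ) k := fun t => hmin t.2
    have : Nonempty {t | ∀ s, f s ≤ f t} := ⟨⟨t₀, ht₀⟩⟩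
    have hbdd : BddBelow (Set.range fun t : {t | ∀ s, f s ≤ f t} => (t : Fin d → ℝ) k) :=
      ⟨t₀ k, by rintro _ ⟨t, rfl⟩; exact hlow t⟩
    exact le_antisymm (ciInf_le hbdd (⟨t₀, ht₀⟩ : {t | ∀ s, f s ≤ f t}))
      (le_ciInf hlow)
  rw [h]
  exact ⟨fun h => ⟨t₀, ht₀, h⟩, fun ⟨t, ht, hta⟩ => (hmin ht).trans hta⟩

lemma mem_supOnHalfspace_iff (hf : IsVanishingPath f) (k : Fin d) (a : ℝ) :
    f ∈ supOnHalfspace k a ↔ infArgsup f k ≤ a := by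
  have hdense := TopologicalSpace.denseRange_denseSeq (Fin d → ℝ)
  rw [hf.infArgsup_le_iff]
  constructor
  · intro h
    have hclosed : IsClosed {t : Fin d → ℝ | t k ≤ a} :=
      isClosed_le (continuous_apply k) continuous_const
    obtain ⟨t, hta, ht⟩ := hf.exists_isMaxOn hclosed ⟨fun _ => a, le_refl a⟩
    refine ⟨t, fun s => ?_, hta⟩
    have h1 : ∀ n, f (TopologicalSpace.denseSeq _ n) ≤ f t := by
      intro n
      refine le_of_forall_pos_le_add fun ε hε => ?_
      obtain ⟨N, hN⟩ := exists_nat_one_div_lt hε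
      obtain ⟨l, hl, hfl⟩ := h n N
      have := ht _ (show TopologicalSpace.denseSeq (Fin d → ℝ) l ∈ {t : Fin d → ℝ | t k ≤ a}
        from hl.le)
      linarith
    have h2 : closure (Set.range (TopologicalSpace.denseSeq (Fin d → ℝ))) ⊆ {s | f s ≤ f t} :=
      closure_minimal (by rintro _ ⟨n, rfl⟩; exact h1 n)
        (isClosed_le hf.continuous continuous_const)
    exact h2 (hdense s)
  · rintro ⟨t, ht, hta⟩ n N
    have hpos : (0 : ℝ) < 1 / (N + 1) := by positivity
    have hopen : IsOpen {s | f t - 1 / (N + 1) < f s} := isOpen_lt continuous_const hf.continuous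
    obtain ⟨ε, hε, hball⟩ := Metric.isOpen_iff.1 hopen t (show f t - 1 / (N + 1) < f t by linarith)
    have hopen' : IsOpen ({s | f t - 1 / (N + 1) < f s} ∩ {s : Fin d → ℝ | s k < a}) :=
      hopen.inter (isOpen_lt (continuous_apply k) continuous_const)
    have hne : ({s | f t - 1 / (N + 1) < f s} ∩ {s : Fin d → ℝ | s k < a}).Nonempty := by
      -- The maximiser may lie on the hyperplane `t k = a`, so it is pushed into the open
      -- half-space.
      refine ⟨Function.update t k (t k - ε / 2), hball ?_, ?_⟩
      · rw [Metric.mem_ball, dist_pi_lt_iff hε]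
        intro i
        by_cases hi : i = k
        · subst hi
          simp only [Function.update_self, Real.dist_eq]
          rw [show t i - ε / 2 - t i = -(ε / 2) by ring, abs_neg, abs_of_pos (by linarith)]
          linarith
        · simp [Function.update_of_ne hi, hε]
      · simp only [Set.mem_ofPred_eq, Function.update_self]
        linarith
    obtain ⟨l, hl⟩ := hdense.exists_mem_open hopen' hne
    exact ⟨l, hl.2, by have := ht (TopologicalSpace.denseSeq _ n); have := hl.1.out; linarith⟩

lemma shift (hf : IsVanishingPath f) (u : Fin d → ℝ) : IsVanishingPath fun t => f (u + t) :=
  ⟨hf.continuous.comp (continuous_const_add u),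
    hf.tendsto.comp (by
      rw [Metric.cobounded_eq_cocompact]
      exact (Homeomorph.addLeft u).isClosedEmbedding.tendsto_cocompact)⟩

lemma infArgsup_shift_le_iff (hf : IsVanishingPath f) (u : Fin d → ℝ) (k : Fin d) (a : ℝ) :
    infArgsup (fun t => f (u + t)) k ≤ a ↔ infArgsup f k ≤ a + u k := by
  rw [(hf.shift u).infArgsup_le_iff, hf.infArgsup_le_iff]
  constructor
  · rintro ⟨t, ht, hta⟩
    refine ⟨u + t, fun s => ?_, by simp only [Pi.add_apply]; linarith⟩
    simpa using ht (s - u)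
  · rintro ⟨t, ht, hta⟩
    refine ⟨t - u, fun s => ?_, by simpa using hta⟩
    simpa using ht (u + s)

end IsVanishingPath

/-- A measurable set of paths which, for continuous paths `f` tending to `-∞`, describes the event
`infArgsup f ∈ (lo, hi]`. -/
def argsupIn (lo hi : Fin d → ℝ) : Set ((Fin d → ℝ) → ℝ) :=
  {f | ∀ k, f ∉ supOnHalfspace k (lo k) ∧ f ∈ supOnHalfspace k (hi k)}

lemma measurableSet_argsupIn (lo hi : Fin d → ℝ) : MeasurableSet (argsupIn lo hi) := by
  have : argsupIn lo hi = ⋂ k, (supOnHalfspace k (lo k))ᶜ ∩ supOnHalfspace k (hi k) := by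
    ext f; simp [argsupIn]
  rw [this]
  exact MeasurableSet.iInter fun k =>
    (measurableSet_supOnHalfspace k _).compl.inter (measurableSet_supOnHalfspace k _)

lemma const_add_mem_argsupIn {lo hi : Fin d → ℝ} {f : (Fin d → ℝ) → ℝ} (c : ℝ) :
    (fun t => c + f t) ∈ argsupIn lo hi ↔ f ∈ argsupIn lo hi := by
  simp only [argsupIn, Set.mem_ofPred_eq, const_add_mem_supOnHalfspace]

lemma IsVanishingPath.mem_argsupIn_iff {f : (Fin d → ℝ) → ℝ} (hf : IsVanishingPath f)
    (lo hi : Fin d → ℝ) :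
    f ∈ argsupIn lo hi ↔ ∀ k, infArgsup f k ∈ Set.Ioc (lo k) (hi k) := by
  simp only [argsupIn, Set.mem_ofPred_eq, hf.mem_supOnHalfspace_iff, not_le, Set.mem_Ioc]

lemma IsVanishingPath.shift_mem_argsupIn_iff {f : (Fin d → ℝ) → ℝ} (hf : IsVanishingPath f)
    (lo hi u : Fin d → ℝ) :
    (fun t => f (u + t)) ∈ argsupIn lo hi ↔ f ∈ argsupIn (lo + u) (hi + u) := by
  rw [(hf.shift u).mem_argsupIn_iff, hf.mem_argsupIn_iff]
  simp only [Set.mem_Ioc, ← not_le, hf.infArgsup_shift_le_iff, Pi.add_apply]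

/-- Every point is covered by exactly `m ^ d` of the translates by `p · j` of the box
`(-mp/2, mp/2]`. -/
lemma tsum_indicator_box (m : ℕ) {p : Fin d → ℝ} (hp : ∀ k, 0 < p k) (T : Fin d → ℝ) :
    ∑' j : Fin d → ℤ, Set.indicator {j : Fin d → ℤ | ∀ k, T k ∈
      Set.Ioc (-(m * p k / 2) + latticePoint p j k) (m * p k / 2 + latticePoint p j k)}
      (fun _ => (1 : ENNReal)) j = (m : ENNReal) ^ d := by
  -- Coordinatewise the condition reads `T k / p k - m / 2 ≤ j k < T k / p k + m / 2`, a half-open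
  -- interval of length `m`, which contains exactly `m` integers.
  have h : {j : Fin d → ℤ | ∀ k, T k ∈
      Set.Ioc (-(m * p k / 2) + latticePoint p j k) (m * p k / 2 + latticePoint p j k)} =
      ↑(Fintype.piFinset fun k =>
        Finset.Ico ⌈T k / p k - m / 2⌉ (⌈T k / p k - m / 2⌉ + m)) := by
    ext j
    simp only [Set.mem_ofPred_eq, Finset.mem_coe, Fintype.mem_piFinset, Finset.mem_Ico, Int.ceil_le,
      latticePoint, Set.mem_Ioc]
    refine forall_congr' fun k => ?_
    have e1 : j k < ⌈T k / p k - m / 2⌉ + m ↔ (j k : ℝ) < T k / p k + m / 2 := by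
      rw [← sub_lt_iff_lt_add, Int.lt_ceil]
      push_cast
      constructor <;> intro h <;> linarith
    rw [e1, and_comm, sub_le_iff_le_add, div_le_iff₀ (hp k), ← sub_lt_iff_lt_add, lt_div_iff₀ (hp k)]
    have := hp k
    constructor <;> rintro ⟨h1, h2⟩ <;> constructor <;> nlinarith
  rw [← tsum_subtype, h]
  simp

end Argsup

/-! ### Maxima over marked Poisson points -/

section Maxima

/-- Both sides are `0` for empty and for unbounded sets. Measurability of suprema thus follows from
`EReal`, where excluded indices can be given the value `⊥`. -/
lemma sSup_eq_toReal (S : Set ℝ) : sSup S = (⨆ v ∈ S, (v : EReal)).toReal := by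
  rcases S.eq_empty_or_nonempty with rfl | hne
  · simp
  by_cases hb : BddAbove S
  · have h : ⨆ v ∈ S, (v : EReal) = ((sSup S : ℝ) : EReal) := by
      refine le_antisymm (iSup₂_le fun v hv => by exact_mod_cast le_csSup hb hv) ?_
      refine le_of_forall_lt fun c hc => ?_
      induction c with
      | bot =>
        obtain ⟨v, hv⟩ := hne
        exact (EReal.bot_lt_coe v).trans_le (le_iSup₂ (f := fun v (_ : v ∈ S) => (v : EReal)) v hv)
      | top => simp at hc
      | coe c =>
        obtain ⟨v, hv, hcv⟩ := exists_lt_of_lt_csSup hne (by exact_mod_cast hc : c < sSup S)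
        exact (EReal.coe_lt_coe_iff.2 hcv).trans_le
          (le_iSup₂ (f := fun v (_ : v ∈ S) => (v : EReal)) v hv)
    rw [h, EReal.toReal_coe]
  · have h : ⨆ v ∈ S, (v : EReal) = ⊤ := by
      refine EReal.eq_top_iff_forall_lt _ |>.2 fun c => ?_
      obtain ⟨v, hv, hcv⟩ := not_bddAbove_iff.1 hb c
      exact (EReal.coe_lt_coe_iff.2 hcv).trans_le
        (le_iSup₂ (f := fun v (_ : v ∈ S) => (v : EReal)) v hv)
    rw [h, EReal.toReal_top, Real.sSup_of_not_bddAbove hb]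

lemma measurable_sSup_countable {Ω Q : Type*} [MeasurableSpace Ω] [Countable Q] {G : Q → Set Ω}
    (hG : ∀ q, MeasurableSet (G q)) {g : Q → Ω → ℝ} (hg : ∀ q, Measurable (g q)) :
    Measurable fun ω => sSup {v | ∃ q, ω ∈ G q ∧ v = g q ω} := by
  classical
  have h : ∀ ω, sSup {v | ∃ q, ω ∈ G q ∧ v = g q ω} =
      (⨆ q, if ω ∈ G q then (g q ω : EReal) else ⊥).toReal := by
    intro ω
    rw [sSup_eq_toReal]
    congr 1
    refine le_antisymm (iSup₂_le ?_) (iSup_le fun q => ?_)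
    · rintro _ ⟨q, hq, rfl⟩
      exact le_iSup_of_le q (by rw [if_pos hq])
    · split_ifs with hq
      · exact le_iSup₂ (f := fun v (_ : v ∈ {v | ∃ q, ω ∈ G q ∧ v = g q ω}) => (v : EReal)) _
          ⟨q, hq, rfl⟩
      · exact bot_le
  simp_rw [h]
  exact (Measurable.iSup fun q =>
    Measurable.ite (hG q) (hg q).coe_real_ereal measurable_const).ereal_toReal

variable {d : ℕ}

/-- The values at `t` of the paths `X j i + D (V j i) (u j + ·)`, over all `j` and `i` such that
`D (V j i)` belongs to `A`. -/
def pathValues {J Ω : Type*} (X : J → ℕ → Ω → ℝ) (V : J → ℕ → Ω → (Fin d → ℝ) → ℝ)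
    (D : ((Fin d → ℝ) → ℝ) → (Fin d → ℝ) → ℝ) (A : Set ((Fin d → ℝ) → ℝ)) (u : J → Fin d → ℝ)
    (t : Fin d → ℝ) (ω : Ω) : Set ℝ :=
  {v | ∃ q : J × ℕ, D (V q.1 q.2 ω) ∈ A ∧ v = X q.1 q.2 ω + D (V q.1 q.2 ω) (u q.1 + t)}

variable {J Ω : Type*} [MeasurableSpace Ω] {P : Measure Ω} {X : J → ℕ → Ω → ℝ}
  {V : J → ℕ → Ω → (Fin d → ℝ) → ℝ} {μ : Measure ℝ} {ν Λ : Measure ((Fin d → ℝ) → ℝ)}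
  {D : ((Fin d → ℝ) → ℝ) → (Fin d → ℝ) → ℝ} {A : Set ((Fin d → ℝ) → ℝ)} {u : J → Fin d → ℝ}

lemma measurableSet_pathSet (hD : Measurable D) (hA : MeasurableSet A) (v : Fin d → ℝ)
    {S : Set ((Fin d → ℝ) → ℝ)} (hS : MeasurableSet S) :
    MeasurableSet {z : ℝ × ((Fin d → ℝ) → ℝ) | D z.2 ∈ A ∧ (fun t => z.1 + D z.2 (v + t)) ∈ S} := by
  refine (hD.comp measurable_snd hA).inter (MeasurableSet.preimage hS ?_)
  exact measurable_pi_lambda _ fun t =>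
    measurable_fst.add ((measurable_pi_apply _).comp (hD.comp measurable_snd))

namespace IsMarkedPoissonFamily

variable [Countable J]

lemma measurable_sSup_pathValues (h : IsMarkedPoissonFamily X V μ ν P) (hD : Measurable D)
    (hA : MeasurableSet A) : Measurable fun ω t => sSup (pathValues X V D A u t ω) :=
  measurable_pi_lambda _ fun _ => measurable_sSup_countable
    (G := fun q : J × ℕ => {ω | D (V q.1 q.2 ω) ∈ A})
    (fun q => (hD.comp (h.measurable_mark q.1 q.2)) hA)
    (fun q => (h.measurable_point q.1 q.2).add
      ((measurable_pi_apply _).comp (hD.comp (h.measurable_mark q.1 q.2))))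

variable [IsProbabilityMeasure P] [IsProbabilityMeasure ν]

/-- The maximum over all marked points exists almost surely. -/
theorem isGreatest_sSup_pathValues (h : IsMarkedPoissonFamily X V μ ν P) (hD : Measurable D)
    (hA : MeasurableSet A)
    (hΛ : ∀ S, MeasurableSet S → ∑' j, (μ.prod ν)
      {z | D z.2 ∈ A ∧ (fun t => z.1 + D z.2 (u j + t)) ∈ S} = Λ S)
    (hexp : ∀ t y, Λ {f | y < f t} = ENNReal.ofReal (Real.exp (-y))) (t : Fin d → ℝ) :
    ∀ᵐ ω ∂P, IsGreatest (pathValues X V D A u t ω) (sSup (pathValues X V D A u t ω)) := by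
  have hS : ∀ y : ℝ, MeasurableSet {f : (Fin d → ℝ) → ℝ | y < f t} := fun y =>
    measurableSet_lt measurable_const (measurable_pi_apply t)
  -- Borel–Cantelli: the expected number of paths above `-N` at `t` is `e^N`.
  have hfin : ∀ᵐ ω ∂P, ∀ N : ℕ, {q : J × ℕ | D (V q.1 q.2 ω) ∈ A ∧
      -(N : ℝ) < X q.1 q.2 ω + D (V q.1 q.2 ω) (u q.1 + t)}.Finite := by
    refine ae_all_iff.2 fun N => ae_finite_setOfPred_mem (s := fun q : J × ℕ =>
      {ω | D (V q.1 q.2 ω) ∈ A ∧ -(N : ℝ) < X q.1 q.2 ω + D (V q.1 q.2 ω) (u q.1 + t)}) ?_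
    have h1 := h.tsum_measure_mem fun j => measurableSet_pathSet hD hA (u j) (hS (-N))
    rw [hΛ _ (hS _), hexp] at h1
    exact h1 ▸ ENNReal.ofReal_ne_top
  -- No path exceeds `-N` at `t` with probability `exp(-e^N)`, which tends to `0`.
  have hne : ∀ᵐ ω ∂P, ∃ N : ℕ, ∃ q : J × ℕ, D (V q.1 q.2 ω) ∈ A ∧
      -(N : ℝ) < X q.1 q.2 ω + D (V q.1 q.2 ω) (u q.1 + t) := by
    rw [ae_iff]
    have hle : ∀ N : ℕ, P {ω | ¬ ∃ N : ℕ, ∃ q : J × ℕ, D (V q.1 q.2 ω) ∈ A ∧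
        -(N : ℝ) < X q.1 q.2 ω + D (V q.1 q.2 ω) (u q.1 + t)} ≤
        expNeg (ENNReal.ofReal (Real.exp N)) := by
      intro N
      have h1 := h.measure_forall_notMem fun j => measurableSet_pathSet hD hA (u j) (hS (-N))
      rw [hΛ _ (hS _), hexp, neg_neg] at h1
      rw [← h1]
      exact measure_mono fun ω hω j i hq => hω ⟨N, (j, i), hq⟩
    have hlim : Tendsto (fun N : ℕ => expNeg (ENNReal.ofReal (Real.exp N))) atTop (𝓝 0) := by
      rw [← expNeg_top]
      exact (continuous_expNeg.tendsto _).comp (ENNReal.tendsto_ofReal_nhds_top.2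
        (Real.tendsto_exp_atTop.comp tendsto_natCast_atTop_atTop))
    exact le_antisymm (ge_of_tendsto' hlim hle) zero_le
  filter_upwards [hfin, hne] with ω hfin ⟨N, q₀, hq₀, hlt⟩
  obtain ⟨q, hq, hmax⟩ := Set.exists_max_image _
    (fun q : J × ℕ => X q.1 q.2 ω + D (V q.1 q.2 ω) (u q.1 + t)) (hfin N) ⟨q₀, hq₀, hlt⟩
  have hg : IsGreatest (pathValues X V D A u t ω)
      (X q.1 q.2 ω + D (V q.1 q.2 ω) (u q.1 + t)) := by
    refine ⟨⟨q, hq.1, rfl⟩, ?_⟩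
    rintro _ ⟨r, hr, rfl⟩
    by_cases hrN : -(N : ℝ) < X r.1 r.2 ω + D (V r.1 r.2 ω) (u r.1 + t)
    · exact hmax r ⟨hr, hrN⟩
    · exact (not_lt.1 hrN).trans hq.2.le
  rwa [hg.csSup_eq]

/-- The finite-dimensional distribution functions of the field of maxima. -/
theorem measure_sSup_pathValues_le (h : IsMarkedPoissonFamily X V μ ν P) (hD : Measurable D)
    (hA : MeasurableSet A)
    (hΛ : ∀ S, MeasurableSet S → ∑' j, (μ.prod ν)
      {z | D z.2 ∈ A ∧ (fun t => z.1 + D z.2 (u j + t)) ∈ S} = Λ S)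
    (hexp : ∀ t y, Λ {f | y < f t} = ENNReal.ofReal (Real.exp (-y)))
    (I : Finset (Fin d → ℝ)) (y : (Fin d → ℝ) → ℝ) :
    P {ω | ∀ t ∈ I, sSup (pathValues X V D A u t ω) ≤ y t} =
      expNeg (Λ {f | ∃ t ∈ I, y t < f t}) := by
  have hS : MeasurableSet {f : (Fin d → ℝ) → ℝ | ∃ t ∈ I, y t < f t} := by
    have : {f : (Fin d → ℝ) → ℝ | ∃ t ∈ I, y t < f t} = ⋃ t ∈ I, {f | y t < f t} := by
      ext; simp
    rw [this]
    exact Finset.measurableSet_biUnion I fun t _ =>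
      measurableSet_lt measurable_const (measurable_pi_apply t)
  rw [← hΛ _ hS, ← h.measure_forall_notMem fun j => measurableSet_pathSet hD hA (u j) hS]
  -- Attainment makes the two events agree; the default value `0` of `sSup` on empty or unbounded
  -- sets would not.
  have hg : ∀ᵐ ω ∂P, ∀ t : I,
      IsGreatest (pathValues X V D A u t ω) (sSup (pathValues X V D A u t ω)) :=
    ae_all_iff.2 fun t => h.isGreatest_sSup_pathValues hD hA hΛ hexp t
  refine measure_congr ?_
  filter_upwards [hg] with ω hω
  refine propext ⟨fun hle j i hq => ?_, fun hle t ht => ?_⟩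
  · obtain ⟨hqA, t, ht, hlt⟩ := hq
    exact absurd ((hω ⟨t, ht⟩).2 ⟨(j, i), hqA, rfl⟩) (not_le.2 ((hle t ht).trans_lt hlt))
  · obtain ⟨q, hq, heq⟩ := (hω ⟨t, ht⟩).1
    by_contra hlt
    exact hle q.1 q.2 ⟨hq, t, ht, by rw [← heq]; exact not_le.1 hlt⟩

end IsMarkedPoissonFamily

lemma Measure.ext_of_pi_Iic {ι : Type*} [Fintype ι] {μ ν : Measure (ι → ℝ)}
    [IsProbabilityMeasure μ] [IsProbabilityMeasure ν]
    (h : ∀ y : ι → ℝ, μ {v | ∀ i, v i ≤ y i} = ν {v | ∀ i, v i ≤ y i}) : μ = ν := by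
  have hspan : ∀ _ : ι, IsCountablySpanning (Set.range (Set.Iic : ℝ → Set ℝ)) := fun _ =>
    ⟨fun n : ℕ => Set.Iic (n : ℝ), fun n => ⟨n, rfl⟩, by
      refine Set.eq_univ_of_forall fun x => ?_
      obtain ⟨n, hn⟩ := exists_nat_ge x
      exact Set.mem_iUnion.2 ⟨n, hn⟩⟩
  have hgen : (MeasurableSpace.pi : MeasurableSpace (ι → ℝ)) = MeasurableSpace.generateFrom
      (Set.univ.pi '' Set.univ.pi fun _ => Set.range (Set.Iic : ℝ → Set ℝ)) := by
    rw [← generateFrom_pi_eq hspan]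
    congr 1
    ext1 i
    rw [← borel_eq_generateFrom_Iic]
    exact BorelSpace.measurable_eq
  refine ext_of_generate_finite _ hgen (IsPiSystem.pi fun _ => isPiSystem_Iic) ?_ (by simp)
  rintro _ ⟨s, hs, rfl⟩
  choose y hy using fun i => hs i trivial
  have : Set.univ.pi s = {v | ∀ i, v i ≤ y i} := by
    ext v
    simp [← hy]
  rw [this, h]

/-- Two random fields with the same finite-dimensional distribution functions are identically
distributed. -/
lemma identDistrib_of_forall_measure_le {T Ω' : Type*} [MeasurableSpace Ω'] {P' : Measure Ω'}
    [IsProbabilityMeasure P] [IsProbabilityMeasure P'] {Y : Ω → T → ℝ} {Y' : Ω' → T → ℝ}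
    (hY : Measurable Y) (hY' : Measurable Y')
    (h : ∀ (I : Finset T) (y : T → ℝ),
      P {ω | ∀ t ∈ I, Y ω t ≤ y t} = P' {ω | ∀ t ∈ I, Y' ω t ≤ y t}) :
    IdentDistrib Y Y' P P' := by
  classical
  refine ⟨hY.aemeasurable, hY'.aemeasurable, ?_⟩
  have := Measure.isProbabilityMeasure_map hY.aemeasurable (μ := P)
  have := Measure.isProbabilityMeasure_map hY'.aemeasurable (μ := P')
  have hI : ∀ I : Finset T, IsProbabilityMeasure ((P.map Y).map I.restrict) := fun I =>
    Measure.isProbabilityMeasure_map (Finset.measurable_restrict I).aemeasurable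
  have hI' : ∀ I : Finset T, IsProbabilityMeasure ((P'.map Y').map I.restrict) := fun I =>
    Measure.isProbabilityMeasure_map (Finset.measurable_restrict I).aemeasurable
  refine IsProjectiveLimit.unique (P := fun I : Finset T => (P.map Y).map I.restrict)
    (fun I => rfl) fun I => (Measure.ext_of_pi_Iic fun y => ?_).symm
  have hr := Finset.measurable_restrict (X := fun _ : T => ℝ) I
  have hs : MeasurableSet {v : I → ℝ | ∀ i, v i ≤ y i} := by
    rw [Set.ofPred_forall]
    exact MeasurableSet.iInter fun i => measurableSet_le (measurable_pi_apply i) measurable_const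
  have hy := h I fun t => if ht : t ∈ I then y ⟨t, ht⟩ else 0
  change ((P.map Y).map I.restrict) _ = _
  rw [Measure.map_map hr hY, Measure.map_map hr hY', Measure.map_apply (hr.comp hY) hs,
    Measure.map_apply (hr.comp hY') hs]
  convert hy using 2
  · ext ω
    simp only [Set.mem_preimage, Set.mem_ofPred_eq, Function.comp_apply, Subtype.forall,
      Finset.restrict]
    exact forall₂_congr fun t ht => by rw [dif_pos ht]
  · ext ω
    simp only [Set.mem_preimage, Set.mem_ofPred_eq, Function.comp_apply, Subtype.forall,
      Finset.restrict]
    exact forall₂_congr fun t ht => by rw [dif_pos ht]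

end Maxima

/-! ### Brown–Resnick processes as maxima over marked Poisson points -/

section BrownResnickLaw

variable {d : ℕ} {Ω₀ : Type*} [MeasurableSpace Ω₀] {P₀ : Measure Ω₀}
  {W : (Fin d → ℝ) → Ω₀ → ℝ}

/-- Subtraction of the drift `σ² / 2` from a path. -/
def subDrift (σ2 : (Fin d → ℝ) → ℝ) (w : (Fin d → ℝ) → ℝ) (t : Fin d → ℝ) : ℝ :=
  w t - σ2 t / 2

lemma measurable_subDrift (σ2 : (Fin d → ℝ) → ℝ) : Measurable (subDrift σ2) :=
  measurable_pi_lambda _ fun t => (measurable_pi_apply t).sub_const _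

lemma IsIntrinsicGaussianField.measurable_path (h : IsIntrinsicGaussianField W P₀) :
    Measurable fun ω t => W t ω :=
  measurable_pi_lambda _ h.measurable

lemma IsIntrinsicGaussianField.prod_pathSet (h : IsIntrinsicGaussianField W P₀)
    {A : Set ((Fin d → ℝ) → ℝ)} (hA : MeasurableSet A) (v : Fin d → ℝ)
    {S : Set ((Fin d → ℝ) → ℝ)} (hS : MeasurableSet S) :
    (expIntensity.prod (P₀.map fun ω t => W t ω))
      {z | subDrift (fun s => variance (W s) P₀) z.2 ∈ A ∧
        (fun t => z.1 + subDrift (fun s => variance (W s) P₀) z.2 (v + t)) ∈ S} =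
      ∫⁻ ω, expIntensity {x | (fun t => driftedField W P₀ t ω) ∈ A ∧
        (fun t => x + driftedField W P₀ (v + t) ω) ∈ S} ∂P₀ := by
  have := h.isProbabilityMeasure
  have := Measure.isProbabilityMeasure_map h.measurable_path.aemeasurable (μ := P₀)
  have hm := measurableSet_pathSet (measurable_subDrift fun s => variance (W s) P₀) hA v hS
  rw [Measure.prod_apply_symm hm,
    lintegral_map (measurable_measure_prodMk_right hm) h.measurable_path]
  rfl

lemma IsIntrinsicGaussianField.prod_pathSet_univ (h : IsIntrinsicGaussianField W P₀)
    {S : Set ((Fin d → ℝ) → ℝ)} (hS : MeasurableSet S) :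
    (expIntensity.prod (P₀.map fun ω t => W t ω))
      {z | subDrift (fun s => variance (W s) P₀) z.2 ∈ Set.univ ∧
        (fun t => z.1 + subDrift (fun s => variance (W s) P₀) z.2 (0 + t)) ∈ S} =
      exponentMeasure (driftedField W P₀) P₀ S := by
  have := h.isProbabilityMeasure
  rw [h.prod_pathSet MeasurableSet.univ 0 hS, exponentMeasure_apply h.measurable_driftedField hS]
  simp

/-- Restricting the maximiser to a box of side lengths `m p` and summing over all translations by
the lattice `p ℤ^d` counts every path `m ^ d` times. -/
theorem IsIntrinsicGaussianField.tsum_prod_pathSet (h : IsIntrinsicGaussianField W P₀)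
    (hlim : ∀ᵐ ω ∂P₀, IsVanishingPath fun t => driftedField W P₀ t ω)
    (m : ℕ) {p : Fin d → ℝ} (hp : ∀ k, 0 < p k)
    {S : Set ((Fin d → ℝ) → ℝ)} (hS : MeasurableSet S) :
    ∑' j : Fin d → ℤ, (expIntensity.prod (P₀.map fun ω t => W t ω))
      {z | subDrift (fun s => variance (W s) P₀) z.2 ∈
          argsupIn (fun k => -(m * p k / 2)) (fun k => m * p k / 2) ∧
        (fun t => z.1 + subDrift (fun s => variance (W s) P₀) z.2 (-latticePoint p j + t)) ∈ S} =
      (m : ENNReal) ^ d * exponentMeasure (driftedField W P₀) P₀ S := by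
  have := h.isProbabilityMeasure
  set lo : Fin d → ℝ := fun k => -(m * p k / 2)
  set hi : Fin d → ℝ := fun k => m * p k / 2
  let B : (Fin d → ℤ) → Set ((Fin d → ℝ) → ℝ) := fun j =>
    argsupIn (lo + latticePoint p j) (hi + latticePoint p j)
  have hB : ∀ j, MeasurableSet (B j ∩ S) := fun j => (measurableSet_argsupIn _ _).inter hS
  -- Translation invariance trades the shift of the path for a shift of the box containing its
  -- maximiser.
  have hterm : ∀ j, (expIntensity.prod (P₀.map fun ω t => W t ω))
      {z | subDrift (fun s => variance (W s) P₀) z.2 ∈ argsupIn lo hi ∧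
        (fun t => z.1 + subDrift (fun s => variance (W s) P₀) z.2 (-latticePoint p j + t)) ∈ S} =
      ∫⁻ ω, expIntensity {x | (fun t => x + driftedField W P₀ t ω) ∈ B j ∩ S} ∂P₀ := by
    intro j
    rw [h.prod_pathSet (measurableSet_argsupIn lo hi) _ hS,
      ← exponentMeasure_apply h.measurable_driftedField (hB j)]
    have h1 := h.exponentMeasure_eq h rfl 0 (-latticePoint p j)
    simp only [zero_add] at h1
    change _ = exponentMeasure (fun t => driftedField W P₀ t) P₀ _
    rw [h1, exponentMeasure_apply (fun t => h.measurable_driftedField _) (hB j)]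
    refine lintegral_congr_ae ?_
    filter_upwards [hlim] with ω hω
    congr 1
    ext x
    simp only [Set.mem_ofPred_eq, Set.mem_inter_iff, B, const_add_mem_argsupIn]
    rw [hω.shift_mem_argsupIn_iff, add_neg_cancel_right, add_neg_cancel_right]
  have hE : ∀ {S' : Set ((Fin d → ℝ) → ℝ)}, MeasurableSet S' → Measurable fun ω =>
      expIntensity {x | (fun t => x + driftedField W P₀ t ω) ∈ S'} := fun hS' =>
    measurable_measure_prodMk_right (measurable_const_add_field h.measurable_driftedField hS')
  simp_rw [hterm]
  rw [← lintegral_tsum fun j => (hE (hB j)).aemeasurable,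
    exponentMeasure_apply h.measurable_driftedField hS,
    ← lintegral_const_mul _ (hE hS)]
  refine lintegral_congr_ae ?_
  filter_upwards [hlim] with ω hω
  -- Adding `x` does not move the maximiser, so for fixed `ω` the sum over `j` just counts the boxes
  -- containing it.
  rw [← tsum_indicator_box m hp (infArgsup fun t => driftedField W P₀ t ω),
    ← ENNReal.tsum_mul_right]
  refine tsum_congr fun j => ?_
  have hmem : (fun t => driftedField W P₀ t ω) ∈ B j ↔ j ∈ {j : Fin d → ℤ | ∀ k,
      infArgsup (fun t => driftedField W P₀ t ω) k ∈
        Set.Ioc (-(m * p k / 2) + latticePoint p j k) (m * p k / 2 + latticePoint p j k)} :=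
    hω.mem_argsupIn_iff _ _
  by_cases hj : (fun t => driftedField W P₀ t ω) ∈ B j
  · rw [Set.indicator_of_mem (hmem.1 hj), one_mul]
    simp only [Set.mem_inter_iff, B, const_add_mem_argsupIn]
    congr 1
    ext x
    exact and_iff_right hj
  · rw [Set.indicator_of_notMem fun h => hj (hmem.2 h), zero_mul]
    have : {x | (fun t => x + driftedField W P₀ t ω) ∈ B j ∩ S} = ∅ := by
      refine Set.eq_empty_of_forall_notMem fun x hx => hj ?_
      exact (const_add_mem_argsupIn x).1 hx.1
    rw [this, measure_empty]

/-- The finite-dimensional distribution functions of a Brown–Resnick process. -/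
theorem IsBrownResnickProcess.measurable_and_measure_le {Ω' : Type*} [MeasurableSpace Ω']
    {P' : Measure Ω'} [IsProbabilityMeasure P'] {Z : (Fin d → ℝ) → Ω' → ℝ}
    (h : IsIntrinsicGaussianField W P₀) (hZ : IsBrownResnickProcess (variogram W P₀) Z P') :
    (Measurable fun ω t => Z t ω) ∧ ∀ (I : Finset (Fin d → ℝ)) (y : (Fin d → ℝ) → ℝ),
      P' {ω | ∀ t ∈ I, Z t ω ≤ y t} =
        expNeg (exponentMeasure (driftedField W P₀) P₀ {f | ∃ t ∈ I, y t < f t}) := by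
  obtain ⟨X, V, hV0, hγ, hV, hX, hN, hXV, hZ⟩ := hZ
  -- A Brown–Resnick process is the case of a single index `j`, no restriction on the marks and zero
  -- shift.
  have hM : IsMarkedPoissonFamily (fun (_ : Unit) => X) (fun _ i ω t => V i t ω) expIntensity
      (P'.map fun ω t => V 0 t ω) P' :=
    { measurable_point := fun _ i => hX i
      measurable_mark := fun _ i => measurable_pi_lambda _ (hV.measurable i)
      poisson := fun _ => hN
      indep_poisson := iIndepFun.of_subsingleton
      map_mark := fun _ i => (hV.identDistrib i).map_eq
      indep_mark := hV.indep.precomp (g := fun q : Unit × ℕ => q.2)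
        fun q r hqr => Prod.ext (Subsingleton.elim _ _) hqr
      indep := hXV.comp (φ := fun x (_ : Unit) => x) (ψ := fun w (_ : Unit) => w)
        (measurable_pi_lambda _ fun _ => measurable_id)
        (measurable_pi_lambda _ fun _ => measurable_id) }
  have := Measure.isProbabilityMeasure_map hV0.measurable_path.aemeasurable (μ := P')
  have hZeq : ∀ ω t, Z t ω = sSup (pathValues (fun (_ : Unit) => X) (fun _ i ω t => V i t ω)
      (subDrift fun s => variance (V 0 s) P') Set.univ (fun _ => 0) t ω) := by
    intro ω t
    rw [hZ, iSup]
    congr 1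
    ext v
    simp only [Set.mem_range, pathValues, subDrift, Set.mem_univ, true_and, zero_add,
      Set.mem_ofPred_eq, Prod.exists, exists_const, add_sub_assoc, eq_comm]
  -- `V 0` and `W` share the variogram but possibly not the variance function.
  have hΛ : exponentMeasure (driftedField W P₀) P₀ = exponentMeasure (driftedField (V 0) P') P' := by
    simpa only [zero_add] using h.exponentMeasure_eq hV0 hγ.symm 0 0
  simp_rw [hZeq]
  refine ⟨hM.measurable_sSup_pathValues (measurable_subDrift _) MeasurableSet.univ, fun I y => ?_⟩
  refine hM.measure_sSup_pathValues_le (measurable_subDrift _) MeasurableSet.univ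
    (fun S hS => ?_) h.exponentMeasure_lt I y
  rw [tsum_fintype, Finset.univ_unique, Finset.sum_singleton, hV0.prod_pathSet_univ hS, hΛ]

end BrownResnickLaw

end

/-! ### Existence of the maximum and law of `Z3` -/

theorem mainTheorem4 {d : ℕ}
    -- the underlying Gaussian field `W`
    {Ω₀ : Type*} [MeasurableSpace Ω₀] (P₀ : Measure Ω₀) [IsProbabilityMeasure P₀]
    (W : (Fin d → ℝ) → Ω₀ → ℝ) (hW : IsIntrinsicGaussianField W P₀)
    (hlim : ∀ᵐ ω ∂P₀, Tendsto (fun t => W t ω - variance (W t) P₀ / 2)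
      (Bornology.cobounded (Fin d → ℝ)) atBot)
    (m : ℕ) (hm : 1 ≤ m) (p : Fin d → ℝ) (hp : ∀ k, 0 < p k)
    -- the copies `V j i = W_i^{(j)}` and the Poisson points `X j i = X_i^{(j)}`
    {Ω : Type*} [MeasurableSpace Ω] (P : Measure Ω) [IsProbabilityMeasure P]
    (V : (Fin d → ℤ) → ℕ → (Fin d → ℝ) → Ω → ℝ)
    (hV : AreIndepCopies (fun q : (Fin d → ℤ) × ℕ => V q.1 q.2) P W P₀)
    (X : (Fin d → ℤ) → ℕ → Ω → ℝ) (hX : ∀ j i, Measurable (X j i))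
    (hXpoisson : ∀ j, IsPoissonPointProcess (pointMeasure (X j))
      (((m : ENNReal) ^ d)⁻¹ • expIntensity) P)
    (hXindep : iIndepFun (fun j => pointMeasure (X j)) P)
    (hXV : IndepFun (fun ω j i => X j i ω) (fun ω j i t => V j i t ω) P)
    -- an arbitrary Brown–Resnick process `Z` for the variogram of `W`
    {Ω' : Type*} [MeasurableSpace Ω'] (P' : Measure Ω') [IsProbabilityMeasure P']
    (Z : (Fin d → ℝ) → Ω' → ℝ) (hZ : IsBrownResnickProcess (variogram W P₀) Z P') :
    (∀ t, ∀ᵐ ω ∂P,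
      IsGreatest (shiftedValues X V (fun s => variance (W s) P₀) m p t ω)
        (Z3 X V (fun s => variance (W s) P₀) m p t ω)) ∧
    IdentDistrib (fun ω t => Z3 X V (fun s => variance (W s) P₀) m p t ω)
      (fun ω t => Z t ω) P P' := by
  have := Measure.isProbabilityMeasure_map hW.measurable_path.aemeasurable (μ := P₀)
  have hvan : ∀ᵐ ω ∂P₀, IsVanishingPath fun t => driftedField W P₀ t ω := by
    filter_upwards [hlim] with ω hω using ⟨hW.continuous_driftedField ω, hω⟩
  have hD := measurable_subDrift fun s => variance (W s) P₀
  have hM : IsMarkedPoissonFamily X (fun j i ω t => V j i t ω)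
      (((m : ENNReal) ^ d)⁻¹ • expIntensity) (P₀.map fun ω t => W t ω) P :=
    { measurable_point := hX
      measurable_mark := fun j i => measurable_pi_lambda _ (hV.measurable (j, i))
      poisson := hXpoisson
      indep_poisson := hXindep
      map_mark := fun j i => (hV.identDistrib (j, i)).map_eq
      indep_mark := hV.indep
      indep := hXV }
  have hvanV : ∀ᵐ ω ∂P, ∀ q : (Fin d → ℤ) × ℕ, IsVanishingPath
      (subDrift (fun s => variance (W s) P₀) fun t => V q.1 q.2 t ω) := by
    refine ae_all_iff.2 fun q => ?_
    have h1 : ∀ᵐ ω ∂P₀, (fun t => W t ω) ∈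
        subDrift (fun s => variance (W s) P₀) ⁻¹' vanishingPaths d := by
      filter_upwards [hvan] with ω hω
      exact (mem_vanishingPaths_iff hω.continuous).2 hω
    have h2 := (hV.identDistrib q).symm.ae_mem_snd (hD measurableSet_vanishingPaths) h1
    filter_upwards [h2] with ω hω
    exact (mem_vanishingPaths_iff
      ((hV.continuous q ω).sub (hW.continuous_variance.div_const 2))).1 hω
  have hvalues : ∀ᵐ ω ∂P, ∀ t, shiftedValues X V (fun s => variance (W s) P₀) m p t ω =
      pathValues X (fun j i ω t => V j i t ω) (subDrift fun s => variance (W s) P₀)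
        (argsupIn (fun k => -(m * p k / 2)) fun k => m * p k / 2)
        (fun j => -latticePoint p j) t ω := by
    filter_upwards [hvanV] with ω hω t
    ext v
    simp only [shiftedValues, pathValues, Set.mem_ofPred_eq, Prod.exists]
    refine exists₂_congr fun j i => and_congr ?_ ?_
    · rw [(hω (j, i)).mem_argsupIn_iff, centredBox, Set.mem_univ_pi]
      rfl
    · rw [subDrift, neg_add_eq_sub, add_sub_assoc]
  -- The `m ^ d`-fold covering cancels the factor `m^{-d}` in the Poisson intensity.
  have hΛ : ∀ S, MeasurableSet S → ∑' j : Fin d → ℤ,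
      ((((m : ENNReal) ^ d)⁻¹ • expIntensity).prod (P₀.map fun ω t => W t ω))
        {z | subDrift (fun s => variance (W s) P₀) z.2 ∈
            argsupIn (fun k => -(m * p k / 2)) (fun k => m * p k / 2) ∧
          (fun t => z.1 + subDrift (fun s => variance (W s) P₀) z.2 (-latticePoint p j + t)) ∈ S} =
        exponentMeasure (driftedField W P₀) P₀ S := by
    intro S hS
    have hm0 : (m : ENNReal) ^ d ≠ 0 := pow_ne_zero _ (by exact_mod_cast (by omega : m ≠ 0))
    simp_rw [Measure.prod_smul_left, Measure.smul_apply, smul_eq_mul]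
    rw [ENNReal.tsum_mul_left, hW.tsum_prod_pathSet hvan m hp hS, ← mul_assoc,
      ENNReal.inv_mul_cancel hm0 (ENNReal.pow_ne_top (ENNReal.natCast_ne_top m)), one_mul]
  have hA := measurableSet_argsupIn (fun k => -(m * p k / 2)) fun k => m * p k / 2
  refine ⟨fun t => ?_, ?_⟩
  · filter_upwards [hvalues, hM.isGreatest_sSup_pathValues hD hA hΛ hW.exponentMeasure_lt t]
      with ω h1 h2
    rw [Z3, h1 t]
    exact h2
  · obtain ⟨hZm, hZle⟩ := hZ.measurable_and_measure_le hW
    have hm' := hM.measurable_sSup_pathValues (u := fun j => -latticePoint p j) hD hA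
    -- Off one null set `Z3` agrees for all `t` at once with a measurable field, so `Z3` itself need
    -- only be a.e. measurable.
    refine (IdentDistrib.of_ae_eq hm'.aemeasurable ?_).symm.trans
      (identDistrib_of_forall_measure_le hm' hZm fun I y => ?_)
    · filter_upwards [hvalues] with ω hω
      ext t
      rw [Z3, hω t]
    · rw [hM.measure_sSup_pathValues_le hD hA hΛ hW.exponentMeasure_lt, hZle]
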